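/- Let $d\ge 2$ be an integer. A $d$-ary cloning system consists of groups $(G_n)_{n\ge 1}$, homomorphisms $\rho_n: G_n\to S_n$, and injective maps (not necessarily homomorphisms) $\kappa_k^n: G_n\to G_{n+d-1}$ for $1\le k\le n$, written to the right of their argument, such that for all $g,h\in G_n$: (1) $(gh)\kappa_k^n=(g)\kappa^n_{\rho_n(h)k}\cdot(h)\kappa_k^n$ for $1\le k\le n$; (2) $((g)\kappa_\ell^n)\kappa_k^{n+d-1}=((g)\kappa_k^n)\kappa_{\ell+d-1}^{n+d-1}$ for $1\le k<\ell\le n$; (3) $\rho_{n+d-1}((g)\kappa_k^n)(i)=((\rho_n(g))\varsigma_k^n)(i)$ for $1\le k\le n$ and all $i\in\{1,\dots,n+d-1\}\setminus\{k,\dots,k+d-1\}$, where $\varsigma_k^n:S_n\to S_{n+d-1}$ replaces the $k$-th arrow of the arrow diagram of a permutation by $d$ parallel arrows. It is called diverse if there is $n_0$ with $\bigcap_{k=1}^n\operatorname{Im}\kappa_k^n=\{1\}$ for all $n\ge n_0$. The Thompson-like group $\mathscr{T}_d(G_*)$ is the set of classes $[T,g,U]$ of triples, where $T,U$ are finite rooted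 $d$-ary trees with the same number $n$ of leaves and $g\in G_n$, under the equivalence relation generated by $(T,g,U)\sim(T_{\rho_n(g)(k)},(g)\kappa_k^n,U_k)$ for $1\le k\le n$ ($T_j$ denotes $T$ with a $d$-ary caret glued to its $j$-th leaf), with multiplication $[T,g,U][U,h,W]=[T,gh,W]$. The Higman--Thompson group $F_d$ is its subgroup of all elements $[T,1,U]$. For a group $\Gamma$, $L(\Gamma)$ is the von Neumann algebra on $\ell^2(\Gamma)$ generated by the left regular representation $\lambda$, and for a subgroup $K\le\Gamma$, $L(K)\subseteq L(\Gamma)$ is the von Neumann subalgebra generated by $\{\lambda_k : k\in K\}$. Theorem. For every diverse $d$-ary cloning system on a sequence of groups $(G_n)$: (a) every non-trivial $x\in\mathscr{T}_d(G_*)$ has infinitely many $F_d$-conjugates, i.e. $\{f^{-1}xf : f\in F_d\}$ is infinite; (b) $\mathscr{T}_d(G_*)$ is ICC, i.e. every non-trivial conjugacy class is infinite; (c) the inclusion $L(F_d)\subseteq L(\mathscr{T}_d(G_*))$ is irreducible, i.e. $L(F_d)'\cap L(\mathscr{T}_d(G_*))=Z(L(F_d))$, and in fact $L(F_d)'\cap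 L(\mathscr{T}_d(G_*))=\mathbb{C}1$. -/

import Mathlib

open scoped ENNReal

/-- Finite rooted `d`-ary trees: every non-leaf vertex has exactly `d` (ordered) children. -/
inductive DaryTree (d : ℕ) : Type
  | leaf : DaryTree d
  | node (c : Fin d → DaryTree d) : DaryTree d

namespace DaryTree

variable {d : ℕ}

/-- The number `n(T)` of leaves. -/
def numLeaves : DaryTree d → ℕ
  | leaf => 1
  | node c => ∑ i, (c i).numLeaves

/-- The number of leaves lying in the subtrees to the left of the `i`-th one. -/
def offset (c : Fin d → DaryTree d) (i : Fin d) : ℕ := ∑ j ∈ Finset.Iio i, (c j).numLeaves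

/-- `T.addCaret k` is the tree `T_k` obtained from `T` by gluing a `d`-ary caret to the `k`-th leaf,
where the leaves are numbered `0, …, n(T) - 1` from left to right. (For `k ≥ n(T)` nothing is
glued, see `addCaret_of_le`; so in the second clause only the subtree containing the `k`-th leaf
changes.) -/
def addCaret : DaryTree d → ℕ → DaryTree d
  | leaf, k => if k = 0 then node fun _ => leaf else leaf
  | node c, k => node fun i =>
      if offset c i ≤ k then (c i).addCaret (k - offset c i) else c i

theorem offset_add_le_sum (c : Fin d → DaryTree d) (i : Fin d) (t : Finset (Fin d))
    (ht : insert i (Finset.Iio i) ⊆ t) : offset c i + (c i).numLeaves ≤ ∑ j ∈ t, (c j).numLeaves := by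
  have h := Finset.sum_le_sum_of_subset (f := fun j => (c j).numLeaves) ht
  rw [Finset.sum_insert (by simp)] at h
  unfold offset
  omega

theorem addCaret_of_le (T : DaryTree d) : ∀ k, T.numLeaves ≤ k → T.addCaret k = T := by
  induction T with
  | leaf => intro k hk; simp only [numLeaves] at hk; simp [addCaret]; omega
  | node c ih =>
    intro k hk
    simp only [addCaret, node.injEq]
    funext i
    split_ifs with h
    · apply ih
      have : offset c i + (c i).numLeaves ≤ k :=
        le_trans (offset_add_le_sum c i _ (Finset.subset_univ _)) hk
      omega
    · rfl

theorem offset_add_le {c : Fin d → DaryTree d} {i j : Fin d} (h : i < j) :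
    offset c i + (c i).numLeaves ≤ offset c j := by
  apply offset_add_le_sum
  intro a ha
  simp only [Finset.mem_insert, Finset.mem_Iio] at ha ⊢
  rcases ha with rfl | ha
  · exact h
  · exact ha.trans h

theorem exists_child (c : Fin d → DaryTree d) (k : ℕ) (hk : k < (node c).numLeaves) :
    ∃ i, offset c i ≤ k ∧ k < offset c i + (c i).numLeaves := by
  by_contra! hcon
  have key : ∀ m (hm : m ≤ d), ∑ j ∈ Finset.univ.filter (fun j : Fin d => j.val < m),
      (c j).numLeaves ≤ k := by
    intro m
    induction m with
    | zero => intro _; simp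
    | succ m ih =>
      intro hm
      have e1 : (Finset.univ.filter (fun j : Fin d => j.val < m)) = Finset.Iio ⟨m, hm⟩ := by
        ext a; simp [Fin.lt_def]
      have h1 := ih (by omega)
      rw [e1] at h1
      have h2 := hcon ⟨m, hm⟩ h1
      have e2 : (Finset.univ.filter (fun j : Fin d => j.val < m + 1)) =
          insert ⟨m, hm⟩ (Finset.Iio ⟨m, hm⟩) := by
        ext a
        simp only [Finset.mem_filter, Finset.mem_univ, true_and, Finset.mem_insert,
          Finset.mem_Iio, Fin.lt_def, Fin.ext_iff]
        omega
      rw [e2, Finset.sum_insert (by simp), add_comm]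
      exact h2
  have := key d le_rfl
  simp only [Fin.is_lt, Finset.filter_true] at this
  simp only [numLeaves] at hk
  omega

theorem addCaret_node {c : Fin d → DaryTree d} {k : ℕ} {i : Fin d} (h1 : offset c i ≤ k)
    (h2 : k < offset c i + (c i).numLeaves) :
    (node c).addCaret k = node (Function.update c i ((c i).addCaret (k - offset c i))) := by
  simp only [addCaret, node.injEq]
  funext j
  rcases lt_trichotomy i j with h | rfl | h
  · have := offset_add_le (c := c) h
    rw [Function.update_of_ne h.ne', if_neg]
    unfold offset at *
    omega
  · simp only [Function.update_self]
    rw [if_pos h1]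
  · have := offset_add_le (c := c) h
    rw [Function.update_of_ne h.ne]
    split_ifs with h3
    · apply addCaret_of_le
      unfold offset at *
      omega
    · rfl

theorem offset_update_of_le (c : Fin d → DaryTree d) {i j : Fin d} (h : i ≤ j) (t : DaryTree d) :
    offset (Function.update c j t) i = offset c i := by
  apply Finset.sum_congr rfl
  intro a ha
  rw [Function.update_of_ne]
  rintro rfl
  exact absurd (Finset.mem_Iio.1 ha) (not_lt.2 h)

theorem offset_update_of_lt (c : Fin d → DaryTree d) {i j : Fin d} (h : j < i) (t : DaryTree d) :
    offset (Function.update c j t) i + (c j).numLeaves = offset c i + t.numLeaves := by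
  unfold offset
  rw [← Finset.add_sum_erase _ _ (Finset.mem_Iio.2 h),
    ← Finset.add_sum_erase (Finset.Iio i) (fun j => (c j).numLeaves) (Finset.mem_Iio.2 h)]
  have : ∑ x ∈ (Finset.Iio i).erase j, (Function.update c j t x).numLeaves =
      ∑ x ∈ (Finset.Iio i).erase j, (c x).numLeaves := by
    apply Finset.sum_congr rfl
    intro a ha
    rw [Function.update_of_ne (Finset.ne_of_mem_erase ha)]
  rw [this, Function.update_self]
  ring

theorem numLeaves_addCaret (hd : 2 ≤ d) (T : DaryTree d) :
    ∀ k, k < T.numLeaves → (T.addCaret k).numLeaves = T.numLeaves + (d - 1) := by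
  induction T with
  | leaf =>
    intro k hk
    simp only [numLeaves] at hk
    obtain rfl : k = 0 := by omega
    simp [addCaret, numLeaves]
    omega
  | node c ih =>
    intro k hk
    obtain ⟨i, h1, h2⟩ := exists_child c k hk
    rw [addCaret_node h1 h2]
    have h3 := ih i (k - offset c i) (by omega)
    simp only [numLeaves]
    rw [← Finset.add_sum_erase _ _ (Finset.mem_univ i),
      ← Finset.add_sum_erase Finset.univ (fun j => (c j).numLeaves) (Finset.mem_univ i)]
    have : ∑ x ∈ Finset.univ.erase i,
        (Function.update c i ((c i).addCaret (k - offset c i)) x).numLeaves =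
        ∑ x ∈ Finset.univ.erase i, (c x).numLeaves := by
      apply Finset.sum_congr rfl
      intro a ha
      rw [Function.update_of_ne (Finset.ne_of_mem_erase ha)]
    rw [this, Function.update_self, h3]
    ring

theorem addCaret_comm (hd : 2 ≤ d) (T : DaryTree d) : ∀ k l, k < l → l < T.numLeaves →
    (T.addCaret l).addCaret k = (T.addCaret k).addCaret (l + (d - 1)) := by
  induction T with
  | leaf => intro k l h1 h2; simp only [numLeaves] at h2; omega
  | node c ih =>
    intro k l hkl hl
    obtain ⟨i, hi1, hi2⟩ := exists_child c k (by omega)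
    obtain ⟨j, hj1, hj2⟩ := exists_child c l hl
    rw [addCaret_node hi1 hi2, addCaret_node hj1 hj2]
    have hni := numLeaves_addCaret hd (c i) (k - offset c i) (by omega)
    have hnj := numLeaves_addCaret hd (c j) (l - offset c j) (by omega)
    rcases lt_trichotomy i j with h | rfl | h
    · have e1 := offset_update_of_le c h.le ((c j).addCaret (l - offset c j))
      have e2 := offset_update_of_lt c h ((c i).addCaret (k - offset c i))
      rw [addCaret_node (i := i) (by omega)
        (by rw [e1, Function.update_of_ne h.ne]; omega),
        addCaret_node (i := j) (by omega)
        (by rw [Function.update_of_ne h.ne']; omega), e1,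
        Function.update_of_ne h.ne, Function.update_of_ne h.ne', Function.update_comm h.ne]
      congr 4
      omega
    · have e1 := offset_update_of_le c (le_refl i) ((c i).addCaret (l - offset c i))
      have e2 := offset_update_of_le c (le_refl i) ((c i).addCaret (k - offset c i))
      rw [addCaret_node (i := i) (by omega) (by rw [e1, Function.update_self]; omega),
        addCaret_node (i := i) (by omega) (by rw [e2, Function.update_self]; omega), e1, e2]
      simp only [Function.update_self, Function.update_idem]
      rw [ih i (k - offset c i) (l - offset c i) (by omega) (by omega)]
      congr 4
      omega
    · have := offset_add_le (c := c) h
      omega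

/-- `T.Le T'`: the tree `T'` is obtained from `T` by gluing trees to the leaves of `T`. -/
inductive Le : DaryTree d → DaryTree d → Prop
  | leaf (T : DaryTree d) : Le leaf T
  | node {c c' : Fin d → DaryTree d} (h : ∀ i, Le (c i) (c' i)) : Le (node c) (node c')

theorem Le.refl (T : DaryTree d) : T.Le T := by
  induction T with
  | leaf => exact .leaf _
  | node c ih => exact .node ih

theorem Le.trans {T T' T'' : DaryTree d} (h : T.Le T') (h' : T'.Le T'') : T.Le T'' := by
  induction h generalizing T'' with
  | leaf T => exact .leaf _
  | node _ ih =>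
    cases h' with
    | node h' => exact .node fun i => ih i (h' i)

theorem Le.addCaret (T : DaryTree d) : ∀ k, T.Le (T.addCaret k) := by
  induction T with
  | leaf => intro k; exact .leaf _
  | node c ih =>
    intro k
    refine .node fun i => ?_
    split_ifs
    · exact ih i _
    · exact .refl _

theorem exists_le_le (T T' : DaryTree d) : ∃ S : DaryTree d, T.Le S ∧ T'.Le S := by
  induction T generalizing T' with
  | leaf => exact ⟨T', .leaf _, .refl _⟩
  | node c ih =>
    cases T' with
    | leaf => exact ⟨_, .refl _, .leaf _⟩
    | node c' =>
      choose S h1 h2 using fun i => ih i (c' i)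
      exact ⟨node S, .node h1, .node h2⟩

theorem Le.numLeaves_le (hd : 2 ≤ d) {T T' : DaryTree d} (h : T.Le T') :
    T.numLeaves ≤ T'.numLeaves := by
  induction h with
  | leaf T =>
    induction T with
    | leaf => exact le_rfl
    | node c ih =>
      exact (ih ⟨0, by omega⟩).trans
        (Finset.single_le_sum (f := fun i => (c i).numLeaves) (fun _ _ => Nat.zero_le _)
          (Finset.mem_univ (⟨0, by omega⟩ : Fin d)))
  | node _ ih => exact Finset.sum_le_sum fun i _ => ih i

theorem Le.eq_or_addCaret {T T' : DaryTree d} (h : T.Le T') :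
    T = T' ∨ ∃ k, k < T.numLeaves ∧ (T.addCaret k).Le T' := by
  induction h with
  | leaf T =>
    cases T with
    | leaf => exact .inl rfl
    | node c =>
      refine .inr ⟨0, by simp [numLeaves], ?_⟩
      simp only [DaryTree.addCaret, if_true]
      exact .node fun i => .leaf _
  | @node c c' h ih =>
    by_cases hc : ∀ i, c i = c' i
    · left; rw [funext hc]
    · right
      push Not at hc
      obtain ⟨i, hi⟩ := hc
      obtain ⟨k, hk, hle⟩ := (ih i).resolve_left hi
      refine ⟨offset c i + k, ?_, ?_⟩
      · have : offset c i + (c i).numLeaves ≤ (DaryTree.node c).numLeaves :=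
          offset_add_le_sum c i _ (Finset.subset_univ _)
        omega
      · rw [addCaret_node (i := i) (by omega) (by omega)]
        refine .node fun j => ?_
        by_cases hj : j = i
        · subst hj
          simpa using hle
        · rw [Function.update_of_ne hj]
          exact h j

theorem Le.addCaret_addCaret (hd : 2 ≤ d) (T : DaryTree d) : ∀ (S : DaryTree d) (k l : ℕ),
    k < l → l < T.numLeaves → (T.addCaret k).Le S → (T.addCaret l).Le S →
    ((T.addCaret l).addCaret k).Le S := by
  induction T with
  | leaf => intro S k l h1 h2; simp only [numLeaves] at h2; omega
  | node c ih =>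
    intro S k l hkl hl hk' hl'
    obtain ⟨i, hi1, hi2⟩ := exists_child c k (by omega)
    obtain ⟨j, hj1, hj2⟩ := exists_child c l hl
    rw [addCaret_node hi1 hi2] at hk'
    rw [addCaret_node hj1 hj2] at hl' ⊢
    obtain _ | @⟨_, c', hk'⟩ := hk'
    obtain _ | ⟨hl'⟩ := hl'
    have hnj := numLeaves_addCaret hd (c j) (l - offset c j) (by omega)
    rcases lt_trichotomy i j with h | rfl | h
    · have e1 := offset_update_of_le c h.le ((c j).addCaret (l - offset c j))
      rw [addCaret_node (i := i) (by omega)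
        (by rw [e1, Function.update_of_ne h.ne]; omega), e1, Function.update_of_ne h.ne]
      refine .node fun a => ?_
      by_cases ha : a = i
      · subst ha
        simpa using hk' a
      · rw [Function.update_of_ne ha]
        exact hl' a
    · have e1 := offset_update_of_le c (le_refl i) ((c i).addCaret (l - offset c i))
      rw [addCaret_node (i := i) (by omega) (by rw [e1, Function.update_self]; omega), e1]
      simp only [Function.update_self, Function.update_idem]
      refine .node fun a => ?_
      by_cases ha : a = i
      · subst ha
        have h1 := hk' a
        have h2 := hl' a
        simp only [Function.update_self] at h1 h2 ⊢
        exact ih a _ _ _ (by omega) (by omega) h1 h2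
      · rw [Function.update_of_ne ha]
        have h2 := hl' a
        rwa [Function.update_of_ne ha] at h2
    · have := offset_add_le (c := c) h
      omega

end DaryTree

/-- The `d`-ary clone, at the `k`-th arrow, of a permutation `σ` of `{0, …, n - 1}`, as a function:
the arrow `k ↦ σ k` is replaced by the `d` parallel arrows `k + j ↦ σ k + j` for `0 ≤ j < d`, and
the sources right of `k` and the targets right of `σ k` are shifted by `d - 1`. -/
def stdCloneFun (d n : ℕ) (k : Fin n) (σ : Equiv.Perm (Fin n)) (i : Fin (n + (d - 1))) :
    Fin (n + (d - 1)) :=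
  if h : i.val < k.val then
    if σ ⟨i.val, by omega⟩ < σ k then ⟨(σ ⟨i.val, by omega⟩).val, by omega⟩
    else ⟨(σ ⟨i.val, by omega⟩).val + (d - 1), by omega⟩
  else if h' : i.val ≤ k.val + (d - 1) then
    ⟨(σ k).val + (i.val - k.val), by omega⟩
  else
    if σ ⟨i.val - (d - 1), by omega⟩ < σ k then ⟨(σ ⟨i.val - (d - 1), by omega⟩).val, by omega⟩
    else ⟨(σ ⟨i.val - (d - 1), by omega⟩).val + (d - 1), by omega⟩

theorem stdCloneFun_leftInverse (d n : ℕ) (k : Fin n) (σ : Equiv.Perm (Fin n)) :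
    Function.LeftInverse (stdCloneFun d n (σ k) σ⁻¹) (stdCloneFun d n k σ) := by
  intro i
  have key : ∀ j : Fin n, j ≠ k → (if σ j < σ k then
      stdCloneFun d n (σ k) σ⁻¹ ⟨(σ j).val, by omega⟩ else
      stdCloneFun d n (σ k) σ⁻¹ ⟨(σ j).val + (d - 1), by omega⟩).val =
      if j < k then j.val else j.val + (d - 1) := by
    intro j hj
    have hne : σ j ≠ σ k := fun h => hj (σ.injective h)
    have hne' : (σ j).val ≠ (σ k).val := fun h => hne (Fin.ext h)
    split_ifs with h1 h2 h2
    · have h1' : (σ j).val < (σ k).val := h1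
      simp [stdCloneFun, h1', h2]
    · have h1' : (σ j).val < (σ k).val := h1
      simp [stdCloneFun, h1', h2]
    · have h1' : (σ k).val < (σ j).val := by
        have : ¬ (σ j).val < (σ k).val := h1
        omega
      have a1 : ¬ ((σ j).val + (d - 1) < (σ k).val) := by omega
      have a2 : ¬ (σ j ≤ σ k) := by rw [Fin.le_def]; omega
      simp [stdCloneFun, a1, a2, h2]
    · have h1' : (σ k).val < (σ j).val := by
        have : ¬ (σ j).val < (σ k).val := h1
        omega
      have a1 : ¬ ((σ j).val + (d - 1) < (σ k).val) := by omega
      have a2 : ¬ (σ j ≤ σ k) := by rw [Fin.le_def]; omega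
      simp [stdCloneFun, a1, a2, h2]
  apply Fin.ext
  by_cases h : i.val < k.val
  · have := key ⟨i.val, by omega⟩ (by intro h'; rw [← h'] at h; simp at h)
    conv_lhs => rw [show stdCloneFun d n k σ i = if σ ⟨i.val, by omega⟩ < σ k then
      ⟨(σ ⟨i.val, by omega⟩).val, by omega⟩ else ⟨(σ ⟨i.val, by omega⟩).val + (d - 1), by omega⟩ by
        simp [stdCloneFun, h]]
    rw [apply_ite (stdCloneFun d n (σ k) σ⁻¹), this, if_pos]
    exact h
  · by_cases h' : i.val ≤ k.val + (d - 1)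
    · have e : stdCloneFun d n k σ i = ⟨(σ k).val + (i.val - k.val), by omega⟩ := by
        simp [stdCloneFun, h, h']
      have a1 : ¬ ((σ k).val + (i.val - k.val) < (σ k).val) := by omega
      have a2 : i.val - k.val ≤ d - 1 := by omega
      rw [e]
      simp [stdCloneFun, a2]
      omega
    · have := key ⟨i.val - (d - 1), by omega⟩ (by intro h''; rw [← h''] at h'; simp at h'; omega)
      conv_lhs => rw [show stdCloneFun d n k σ i = if σ ⟨i.val - (d - 1), by omega⟩ < σ k then
        ⟨(σ ⟨i.val - (d - 1), by omega⟩).val, by omega⟩ else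
        ⟨(σ ⟨i.val - (d - 1), by omega⟩).val + (d - 1), by omega⟩ by
          simp [stdCloneFun, h, h']]
      rw [apply_ite (stdCloneFun d n (σ k) σ⁻¹), this, if_neg]
      · simp; omega
      · rw [Fin.lt_def]; simp; omega

/-- The standard `d`-ary cloning map `ς_k^n : S_n → S_{n+d-1}`. -/
def stdClone (d n : ℕ) (k : Fin n) (σ : Equiv.Perm (Fin n)) : Equiv.Perm (Fin (n + (d - 1))) where
  toFun := stdCloneFun d n k σ
  invFun := stdCloneFun d n (σ k) σ⁻¹
  left_inv := stdCloneFun_leftInverse d n k σ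
  right_inv := by
    have := stdCloneFun_leftInverse d n (σ k) σ⁻¹
    simpa [Function.RightInverse] using this

/-- A `d`-ary cloning system (`d ≥ 2`) on a sequence of groups `G`: representation maps `ρ n`,
injective cloning maps `κ n k`, and the axioms (cloning a product), (product of clonings) and
(compatibility). The set `{1, …, n}` is modelled by `Fin n`, that is `{0, …, n - 1}`, and
`G 0` plays no role. -/
structure CloningSystem (d : ℕ) (G : ℕ → Type*) [∀ n, Group (G n)] where
  two_le : 2 ≤ d
  ρ : ∀ n, G n →* Equiv.Perm (Fin n)
  κ : ∀ n, Fin n → G n → G (n + (d - 1))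
  κ_injective : ∀ n k, Function.Injective (κ n k)
  κ_mul : ∀ (n : ℕ) (k : Fin n) (g h : G n), κ n k (g * h) = κ n (ρ n h k) g * κ n k h
  κ_comp : ∀ (n : ℕ) (k l : Fin n) (_ : k < l) (g : G n),
    κ (n + (d - 1)) ⟨k.val, by omega⟩ (κ n l g) =
      κ (n + (d - 1)) ⟨l.val + (d - 1), by omega⟩ (κ n k g)
  ρ_κ : ∀ (n : ℕ) (k : Fin n) (g : G n) (i : Fin (n + (d - 1))),
    (i.val < k.val ∨ k.val + (d - 1) < i.val) →
      ρ (n + (d - 1)) (κ n k g) i = stdClone d n k (ρ n g) i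

/-- A triple `(T, g, U)`, where `T` and `U` are `d`-ary trees with the same number `n` of leaves and
`g ∈ G n`. -/
structure TreeTriple (d : ℕ) (G : ℕ → Type*) where
  n : ℕ
  T : DaryTree d
  g : G n
  U : DaryTree d
  hT : T.numLeaves = n
  hU : U.numLeaves = n

namespace CloningSystem

variable {d : ℕ} {G : ℕ → Type*} [∀ n, Group (G n)] (C : CloningSystem d G)

/-- Diversity: there is `n₀` such that `⋂_k Im κ_k^n = {1}` for all `n ≥ n₀`. -/
def Diverse : Prop :=
  ∃ n₀ : ℕ, ∀ n, n₀ ≤ n → ⋂ k : Fin n, Set.range (C.κ n k) = {1}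

/-- The expansion `(T_{ρ(g)k}, (g)κ_k, U_k)` of the triple `(T, g, U)`. -/
def expand (a : TreeTriple d G) (k : Fin a.n) : TreeTriple d G where
  n := a.n + (d - 1)
  T := a.T.addCaret (C.ρ a.n a.g k)
  g := C.κ a.n k a.g
  U := a.U.addCaret k
  hT := by
    rw [DaryTree.numLeaves_addCaret C.two_le _ _ (by rw [a.hT]; exact Fin.is_lt _), a.hT]
  hU := by
    rw [DaryTree.numLeaves_addCaret C.two_le _ _ (by rw [a.hU]; exact Fin.is_lt _), a.hU]

/-- `b` is an expansion of `a`. -/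
def IsExpansion (a b : TreeTriple d G) : Prop := ∃ k : Fin a.n, b = C.expand a k

/-- The underlying set of the Thompson-like group `𝒯_d(G_*)`: triples modulo the equivalence
relation generated by expansions. -/
def Thompson : Type _ := Quot C.IsExpansion

/-- The class `[T, g, U]`. -/
def cls (a : TreeTriple d G) : C.Thompson := Quot.mk _ a

theorem cls_expand (a : TreeTriple d G) (k : Fin a.n) : C.cls (C.expand a k) = C.cls a :=
  (Quot.sound ⟨k, rfl⟩).symm

theorem κ_one (n : ℕ) (k : Fin n) : C.κ n k 1 = 1 := by
  have h := C.κ_mul n k 1 1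
  simpa using h

theorem κ_inv (n : ℕ) (k : Fin n) (g : G n) : C.κ n (C.ρ n g k) g⁻¹ = (C.κ n k g)⁻¹ := by
  have h := C.κ_mul n k g⁻¹ g
  rw [inv_mul_cancel, κ_one] at h
  exact eq_inv_of_mul_eq_one_left h.symm

theorem expand_comm (a : TreeTriple d G) (k l : Fin a.n) (h : k < l) :
    C.expand (C.expand a l) ⟨k.val, Nat.lt_add_right _ k.2⟩ =
      C.expand (C.expand a k) ⟨l.val + (d - 1), Nat.add_lt_add_right l.2 _⟩ := by
  obtain ⟨n, T, g, U, hT, hU⟩ := a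
  have hd := C.two_le
  have hkl : k.val < l.val := h
  simp only [expand, TreeTriple.mk.injEq, heq_eq_eq, true_and]
  refine ⟨?_, C.κ_comp n k l h g, DaryTree.addCaret_comm hd U k l h (by rw [hU]; exact l.2)⟩
  change Fin n at k l
  have hk : k.val < n := k.2
  have hl : l.val < n := l.2
  change (T.addCaret (C.ρ n g l)).addCaret
      (C.ρ (n + (d - 1)) (C.κ n l g) ⟨k.val, Nat.lt_add_right _ k.2⟩) =
    (T.addCaret (C.ρ n g k)).addCaret
      (C.ρ (n + (d - 1)) (C.κ n k g) ⟨l.val + (d - 1), Nat.add_lt_add_right l.2 _⟩)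
  rw [C.ρ_κ n l g _ (.inl h), C.ρ_κ n k g _ (.inr (by simp; omega))]
  have hne : (C.ρ n g k).val ≠ (C.ρ n g l).val := by
    intro h'
    have := (C.ρ n g).injective (Fin.ext h')
    omega
  have e1 : (stdClone d n l (C.ρ n g) ⟨k.val, by omega⟩).val =
      if (C.ρ n g k).val < (C.ρ n g l).val then (C.ρ n g k).val
      else (C.ρ n g k).val + (d - 1) := by
    simp only [stdClone, Equiv.coe_fn_mk, stdCloneFun, hkl, dif_pos, Fin.lt_def]
    split_ifs <;> rfl
  have e2 : (stdClone d n k (C.ρ n g) ⟨l.val + (d - 1), by omega⟩).val =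
      if (C.ρ n g l).val < (C.ρ n g k).val then (C.ρ n g l).val
      else (C.ρ n g l).val + (d - 1) := by
    have a1 : ¬ (l.val + (d - 1) < k.val) := by omega
    have a2 : ¬ (l.val + (d - 1) ≤ k.val + (d - 1)) := by omega
    simp only [stdClone, Equiv.coe_fn_mk, stdCloneFun, a1, a2, dif_neg, not_false_eq_true,
      Fin.lt_def, Nat.add_sub_cancel]
    split_ifs <;> rfl
  rw [e1, e2]
  rcases lt_or_gt_of_ne hne with hlt | hlt
  · rw [if_pos hlt, if_neg (by omega)]
    exact DaryTree.addCaret_comm hd T _ _ hlt (by rw [hT]; exact Fin.is_lt _)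
  · rw [if_neg (by omega), if_pos hlt]
    exact (DaryTree.addCaret_comm hd T _ _ hlt (by rw [hT]; exact Fin.is_lt _)).symm

/-- `b` is obtained from `a` by finitely many expansions. -/
def Expands : TreeTriple d G → TreeTriple d G → Prop := Relation.ReflTransGen C.IsExpansion

variable {C}

theorem Expands.cls_eq {a b : TreeTriple d G} (h : C.Expands a b) : C.cls a = C.cls b := by
  induction h with
  | refl => rfl
  | tail _ h ih =>
    obtain ⟨k, rfl⟩ := h
    rw [ih, cls_expand]

theorem Expands.le {a b : TreeTriple d G} (h : C.Expands a b) : a.U.Le b.U := by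
  induction h with
  | refl => exact .refl _
  | tail _ h ih =>
    obtain ⟨k, rfl⟩ := h
    exact ih.trans (.addCaret _ _)

/-- Expansions of a triple exist along every expansion of its right tree, and are compatible with
multiplication. -/
theorem exists_expands_mul (n : ℕ) {m : ℕ} (T : DaryTree d) (g : G m) (U : DaryTree d) (h : G m)
    (W : DaryTree d) (hT : T.numLeaves = m) (hU : U.numLeaves = m) (hW : W.numLeaves = m)
    (S : DaryTree d) (hS : U.Le S) (hn : S.numLeaves ≤ m + n) :
    ∃ (m' : ℕ) (T' : DaryTree d) (g' : G m') (h' : G m') (W' : DaryTree d)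
      (hT' : T'.numLeaves = m') (hS' : S.numLeaves = m') (hW' : W'.numLeaves = m'),
      C.Expands ⟨m, T, g, U, hT, hU⟩ ⟨m', T', g', S, hT', hS'⟩ ∧
      C.Expands ⟨m, U, h, W, hU, hW⟩ ⟨m', S, h', W', hS', hW'⟩ ∧
      C.Expands ⟨m, T, g * h, W, hT, hW⟩ ⟨m', T', g' * h', W', hT', hW'⟩ := by
  have hd := C.two_le
  induction n generalizing m T U W with
  | zero =>
    rcases hS.eq_or_addCaret with rfl | ⟨k, hk, hle⟩
    · exact ⟨m, T, g, h, W, hT, hU, hW, .refl, .refl, .refl⟩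
    · have h1 := hle.numLeaves_le hd
      rw [DaryTree.numLeaves_addCaret hd _ _ hk] at h1
      omega
  | succ n ih =>
    rcases hS.eq_or_addCaret with rfl | ⟨k, hk, hle⟩
    · exact ⟨m, T, g, h, W, hT, hU, hW, .refl, .refl, .refl⟩
    · rw [hU] at hk
      set k' : Fin m := (C.ρ m h)⁻¹ ⟨k, hk⟩ with hk'
      have hkk : C.ρ m h k' = ⟨k, hk⟩ := by simp [hk']
      have s1 := (C.expand ⟨m, T, g, U, hT, hU⟩ ⟨k, hk⟩).hT
      have s2 := (C.expand ⟨m, T, g, U, hT, hU⟩ ⟨k, hk⟩).hU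
      have s3 := (C.expand ⟨m, U, h, W, hU, hW⟩ k').hU
      simp only [expand] at s1 s2 s3
      obtain ⟨m', T', g', h', W', hT', hS', hW', a1, a2, a3⟩ :=
        ih (m := m + (d - 1)) _ (C.κ m ⟨k, hk⟩ g) _ (C.κ m k' h) _ s1 s2 s3 hle (by omega)
      refine ⟨m', T', g', h', W', hT', hS', hW', .head ⟨⟨k, hk⟩, rfl⟩ a1, .head ⟨k', ?_⟩ a2,
        .head ⟨k', ?_⟩ a3⟩
      · simp [expand, hkk]
      · simp [expand, hkk, C.κ_mul]

theorem exists_expands (a : TreeTriple d G) (S : DaryTree d) (hS : a.U.Le S) :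
    ∃ b, C.Expands a b ∧ b.U = S := by
  obtain ⟨m', T', g', h', W', hT', hS', hW', a1, -, -⟩ :=
    exists_expands_mul (C := C) S.numLeaves a.T a.g a.U 1 a.U a.hT a.hU a.hU S hS (by omega)
  exact ⟨_, a1, rfl⟩

/-- An expansion of a triple is determined by its right tree. -/
theorem Expands.unique (n : ℕ) {a b b' : TreeTriple d G} (h : C.Expands a b) (h' : C.Expands a b')
    (hb : b.U = b'.U) (hn : b.U.numLeaves ≤ a.n + n) : b = b' := by
  have hd := C.two_le
  have hstep : ∀ (a b : TreeTriple d G) (k : Fin a.n), C.Expands (C.expand a k) b →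
      a.n + (d - 1) ≤ b.U.numLeaves := by
    intro a b k h
    have := h.le.numLeaves_le hd
    rwa [(C.expand a k).hU] at this
  induction n generalizing a b b' with
  | zero =>
    rcases h.cases_head with rfl | ⟨_, ⟨k, rfl⟩, h1⟩
    · rcases h'.cases_head with rfl | ⟨_, ⟨k', rfl⟩, h1'⟩
      · rfl
      · have := hstep _ _ _ h1'
        rw [← hb] at this
        omega
    · have := hstep _ _ _ h1
      omega
  | succ n ih =>
    rcases h.cases_head with rfl | ⟨_, ⟨k, rfl⟩, h1⟩
    · rcases h'.cases_head with rfl | ⟨_, ⟨k', rfl⟩, h1'⟩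
      · rfl
      · have := hstep _ _ _ h1'
        rw [← hb, a.hU] at this
        omega
    · rcases h'.cases_head with rfl | ⟨_, ⟨k', rfl⟩, h1'⟩
      · have := hstep _ _ _ h1
        rw [hb, a.hU] at this
        omega
      · have key : ∀ (k k' : Fin a.n) (b b' : TreeTriple d G), k < k' →
            C.Expands (C.expand a k) b → C.Expands (C.expand a k') b' → b.U = b'.U →
            b.U.numLeaves ≤ a.n + (n + 1) → b = b' := by
          intro k k' b b' hlt h1 h1' hb hn
          have hle : (C.expand (C.expand a k') ⟨k.val, Nat.lt_add_right _ k.2⟩).U.Le b.U := by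
            refine DaryTree.Le.addCaret_addCaret hd a.U b.U k k' hlt (by rw [a.hU]; exact k'.2)
              h1.le ?_
            rw [hb]
            exact h1'.le
          obtain ⟨c, hc, hcU⟩ := exists_expands (C := C) _ _ hle
          have e1 : b' = c := by
            refine ih h1' (.head ⟨_, rfl⟩ hc) (by rw [hcU, hb]) ?_
            simp only [expand]
            rw [← hb]
            omega
          have e2 : b = c := by
            rw [expand_comm C a k k' hlt] at hc
            refine ih h1 (.head ⟨_, rfl⟩ hc) hcU.symm ?_
            simp only [expand]
            omega
          rw [e1, e2]
        rcases lt_trichotomy k k' with hlt | rfl | hlt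
        · exact key k k' b b' hlt h1 h1' hb hn
        · refine ih h1 h1' hb ?_
          simp only [expand]
          omega
        · exact (key k' k b' b hlt h1' h1 hb.symm (by rw [← hb]; exact hn)).symm

theorem cls_eq_iff {a b : TreeTriple d G} :
    C.cls a = C.cls b ↔ ∃ c, C.Expands a c ∧ C.Expands b c := by
  constructor
  · intro h
    have h' : Relation.EqvGen C.IsExpansion a b := Quot.eqvGen_exact h
    have hdiam : ∀ a b c, C.IsExpansion a b → C.IsExpansion a c →
        ∃ e, Relation.ReflGen C.IsExpansion b e ∧ Relation.ReflTransGen C.IsExpansion c e := by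
      rintro a _ _ ⟨k, rfl⟩ ⟨l, rfl⟩
      rcases lt_trichotomy k l with hlt | rfl | hlt
      · refine ⟨_, .single ⟨_, rfl⟩, .single ⟨_, expand_comm C a k l hlt |>.symm⟩⟩
      · exact ⟨_, .refl, .refl⟩
      · refine ⟨_, .single ⟨_, rfl⟩, .single ⟨_, expand_comm C a l k hlt⟩⟩
    clear h
    induction h' with
    | rel a b h => exact ⟨b, .single h, .refl⟩
    | refl a => exact ⟨a, .refl, .refl⟩
    | symm a b _ ih =>
      obtain ⟨c, h1, h2⟩ := ih
      exact ⟨c, h2, h1⟩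
    | trans a b c hab hbc ih1 ih2 =>
      obtain ⟨e, h1, h2⟩ := ih1
      obtain ⟨f, h3, h4⟩ := ih2
      obtain ⟨z, h5, h6⟩ := Relation.church_rosser hdiam h2 h3
      exact ⟨z, h1.trans h5, h4.trans h6⟩
  · rintro ⟨c, h1, h2⟩
    rw [h1.cls_eq, h2.cls_eq]

end CloningSystem

/-- The triple `(U, g⁻¹, T)`. -/
def TreeTriple.inv {d : ℕ} {G : ℕ → Type*} [∀ n, Group (G n)] (a : TreeTriple d G) :
    TreeTriple d G := ⟨a.n, a.U, a.g⁻¹, a.T, a.hU, a.hT⟩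

theorem TreeTriple.inv_inv_eq {d : ℕ} {G : ℕ → Type*} [∀ n, Group (G n)] (a : TreeTriple d G) :
    a.inv.inv = a := by
  obtain ⟨n, T, g, U, hT, hU⟩ := a
  simp only [TreeTriple.inv, TreeTriple.mk.injEq, heq_eq_eq]
  exact ⟨trivial, trivial, _root_.inv_inv g, trivial⟩

namespace CloningSystem

variable {d : ℕ} {G : ℕ → Type*} [∀ n, Group (G n)] {C : CloningSystem d G}

theorem inv_expand (a : TreeTriple d G) (k : Fin a.n) :
    (C.expand a k).inv = C.expand a.inv (C.ρ a.n a.g k) := by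
  have h : (C.ρ a.n a.g⁻¹) (C.ρ a.n a.g k) = k := by simp
  simp only [TreeTriple.inv, expand, κ_inv, TreeTriple.mk.injEq, true_and, and_true, heq_eq_eq]
  exact ⟨congrArg (fun i : Fin a.n => a.U.addCaret i) h.symm, rfl⟩

theorem Expands.inv {a b : TreeTriple d G} (h : C.Expands a b) : C.Expands a.inv b.inv := by
  induction h with
  | refl => exact .refl
  | tail _ h ih =>
    obtain ⟨k, rfl⟩ := h
    exact .tail ih ⟨_, inv_expand _ k⟩

/-- The relation `[T, g, U] [U, h, W] = [T, g h, W]`. -/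
def MulRel (C : CloningSystem d G) (x y z : C.Thompson) : Prop :=
  ∃ (n : ℕ) (T U W : DaryTree d) (g h : G n) (hT : T.numLeaves = n) (hU : U.numLeaves = n)
    (hW : W.numLeaves = n), x = C.cls ⟨n, T, g, U, hT, hU⟩ ∧ y = C.cls ⟨n, U, h, W, hU, hW⟩ ∧
      z = C.cls ⟨n, T, g * h, W, hT, hW⟩

theorem exists_align (a b : TreeTriple d G) : ∃ (n : ℕ) (T U W : DaryTree d) (g h : G n)
    (hT : T.numLeaves = n) (hU : U.numLeaves = n) (hW : W.numLeaves = n),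
    C.Expands a ⟨n, T, g, U, hT, hU⟩ ∧ C.Expands b ⟨n, U, h, W, hU, hW⟩ := by
  obtain ⟨S, h1, h2⟩ := DaryTree.exists_le_le a.U b.T
  obtain ⟨⟨n, T, g, U, hT, hU⟩, ha, rfl⟩ := exists_expands (C := C) a S h1
  obtain ⟨b', hb, hbU⟩ := exists_expands (C := C) b.inv U h2
  have hb' := hb.inv
  rw [TreeTriple.inv_inv_eq] at hb'
  obtain ⟨m, U', h, W, hT', hU'⟩ := b'
  simp only at hbU
  subst hbU
  obtain rfl : n = m := hU.symm.trans hU'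
  exact ⟨n, T, W, U', g, h⁻¹, hT, hU, hT', ha, hb'⟩

theorem exists_mulRel (x y : C.Thompson) : ∃ z, C.MulRel x y z := by
  induction x using Quot.ind with | _ a => ?_
  induction y using Quot.ind with | _ b => ?_
  obtain ⟨n, T, U, W, g, h, hT, hU, hW, ha, hb⟩ := exists_align (C := C) a b
  exact ⟨_, n, T, U, W, g, h, hT, hU, hW, ha.cls_eq, hb.cls_eq, rfl⟩

theorem MulRel.unique {x y z z' : C.Thompson} (h : C.MulRel x y z) (h' : C.MulRel x y z') :
    z = z' := by
  obtain ⟨n, T, U, W, g, h, hT, hU, hW, rfl, rfl, rfl⟩ := h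
  obtain ⟨n', T', U', W', g', h', hT', hU', hW', hx, hy, rfl⟩ := h'
  obtain ⟨a, ha1, ha2⟩ := cls_eq_iff.1 hx
  obtain ⟨b, hb1, hb2⟩ := cls_eq_iff.1 hy
  obtain ⟨m, A, B, D, p, q, hA, hB, hD, hp, hq⟩ := exists_align (C := C) a b
  have key : ∀ (n : ℕ) (T U W : DaryTree d) (g h : G n) (hT : T.numLeaves = n)
      (hU : U.numLeaves = n) (hW : W.numLeaves = n),
      C.Expands ⟨n, T, g, U, hT, hU⟩ a → C.Expands ⟨n, U, h, W, hU, hW⟩ b →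
      C.cls ⟨n, T, g * h, W, hT, hW⟩ = C.cls ⟨m, A, p * q, D, hA, hD⟩ := by
    intro n T U W g h hT hU hW ha hb
    have ha' : C.Expands _ _ := ha.trans hp
    have hb' : C.Expands _ _ := hb.trans hq
    obtain ⟨m', A', p', q', D', hA', hB', hD', e1, e2, e3⟩ :=
      exists_expands_mul (C := C) B.numLeaves T g U h W hT hU hW B ha'.le (by omega)
    have r1 := Expands.unique B.numLeaves ha' e1 rfl (Nat.le_add_left _ _)
    have r2 := Expands.unique B.numLeaves hb'.inv e2.inv rfl (Nat.le_add_left _ _)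
    obtain rfl : m = m' := hB.symm.trans hB'
    simp only [TreeTriple.inv, TreeTriple.mk.injEq, heq_eq_eq, true_and, and_true,
      inv_inj] at r1 r2
    obtain ⟨rfl, rfl⟩ := r1
    obtain ⟨rfl, rfl⟩ := r2
    exact e3.cls_eq
  rw [key n T U W g h hT hU hW ha1 hb1, key n' T' U' W' g' h' hT' hU' hW' ha2 hb2]

variable (C)

theorem cls_one_expands {a b : TreeTriple d G} (h : C.Expands a b) (ha : a.g = 1) (hT : a.T = a.U) :
    b.g = 1 ∧ b.T = b.U := by
  induction h with
  | refl => exact ⟨ha, hT⟩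
  | @tail b _ _ h ih =>
    obtain ⟨k, rfl⟩ := h
    obtain ⟨h1, h2⟩ := ih
    constructor
    · change C.κ b.n k b.g = 1
      rw [h1, κ_one]
    · change b.T.addCaret (C.ρ b.n b.g k) = b.U.addCaret k
      rw [h1, h2]
      simp

theorem Expands.g_eq_one {a b : TreeTriple d G} (h : C.Expands a b) (ha : a.g = 1) : b.g = 1 := by
  induction h with
  | refl => exact ha
  | @tail b _ _ h ih =>
    obtain ⟨k, rfl⟩ := h
    change C.κ b.n k b.g = 1
    rw [ih, κ_one]

noncomputable instance : Mul C.Thompson := ⟨fun x y => (exists_mulRel x y).choose⟩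

instance : One C.Thompson := ⟨C.cls ⟨1, .leaf, 1, .leaf, rfl, rfl⟩⟩

instance : Inv C.Thompson := ⟨Quot.map TreeTriple.inv (by
  rintro a _ ⟨k, rfl⟩
  exact ⟨_, inv_expand a k⟩)⟩

/-- The defining formula `[T, g, U] [U, h, W] = [T, g h, W]` of the multiplication. -/
theorem cls_mul_cls (n : ℕ) (T U W : DaryTree d) (g h : G n) (hT : T.numLeaves = n)
    (hU : U.numLeaves = n) (hW : W.numLeaves = n) :
    C.cls ⟨n, T, g, U, hT, hU⟩ * C.cls ⟨n, U, h, W, hU, hW⟩ = C.cls ⟨n, T, g * h, W, hT, hW⟩ :=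
  MulRel.unique (exists_mulRel _ _).choose_spec
    ⟨n, T, U, W, g, h, hT, hU, hW, rfl, rfl, rfl⟩

theorem cls_inv (a : TreeTriple d G) : (C.cls a)⁻¹ = C.cls a.inv := rfl

theorem cls_one (n : ℕ) (T : DaryTree d) (hT : T.numLeaves = n) :
    C.cls ⟨n, T, 1, T, hT, hT⟩ = 1 := by
  obtain ⟨b, hb, hbU⟩ := exists_expands (C := C) (⟨1, .leaf, 1, .leaf, rfl, rfl⟩ : TreeTriple d G) T
    (.leaf _)
  obtain ⟨h1, h2⟩ := cls_one_expands C hb rfl rfl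
  obtain ⟨m, A, g, B, hA, hB⟩ := b
  simp only at h1 h2 hbU
  subst h2 hbU
  obtain rfl : m = n := hA.symm.trans hT
  rw [h1] at hb
  exact hb.cls_eq.symm

theorem ind_align (x y : C.Thompson) : ∃ (n : ℕ) (T U W : DaryTree d) (g h : G n)
    (hT : T.numLeaves = n) (hU : U.numLeaves = n) (hW : W.numLeaves = n),
    x = C.cls ⟨n, T, g, U, hT, hU⟩ ∧ y = C.cls ⟨n, U, h, W, hU, hW⟩ := by
  obtain ⟨z, n, T, U, W, g, h, hT, hU, hW, hx, hy, -⟩ := exists_mulRel x y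
  exact ⟨n, T, U, W, g, h, hT, hU, hW, hx, hy⟩

/-- The Thompson-like group `𝒯_d(G_*)`. -/
noncomputable instance : Group C.Thompson :=
  Group.ofLeftAxioms
    (by
      intro x y z
      induction x using Quot.ind with | _ a => ?_
      obtain ⟨m, A, B, D, g, h, hA, hB, hD, rfl, rfl⟩ := ind_align C y z
      obtain ⟨n, T, U, W, p, q, hT, hU, hW, ha, hb⟩ :=
        exists_align (C := C) a ⟨m, A, g, B, hA, hB⟩
      obtain ⟨m', A', g', h', D', hA', hB', hD', e1, e2, -⟩ :=
        exists_expands_mul (C := C) W.numLeaves A g B h D hA hB hD W hb.le (by omega)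
      have r1 := Expands.unique W.numLeaves hb e1 rfl (Nat.le_add_left _ _)
      obtain rfl : n = m' := hW.symm.trans hB'
      simp only [TreeTriple.mk.injEq, heq_eq_eq, true_and, and_true] at r1
      obtain ⟨rfl, rfl⟩ := r1
      rw [show (Quot.mk _ a : C.Thompson) = C.cls a from rfl, ha.cls_eq, e1.cls_eq, e2.cls_eq,
        cls_mul_cls, cls_mul_cls, cls_mul_cls, cls_mul_cls, mul_assoc])
    (by
      intro x
      induction x using Quot.ind with | _ a => ?_
      obtain ⟨n, T, g, U, hT, hU⟩ := a
      change 1 * C.cls _ = C.cls _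
      rw [← cls_one C n T hT, cls_mul_cls, one_mul])
    (by
      intro x
      induction x using Quot.ind with | _ a => ?_
      obtain ⟨n, T, g, U, hT, hU⟩ := a
      change C.cls ⟨n, U, g⁻¹, T, hU, hT⟩ * C.cls _ = 1
      rw [cls_mul_cls, inv_mul_cancel, cls_one])

/-- The canonical copy of the Higman--Thompson group `F_d` in `𝒯_d(G_*)`: the subgroup of all
elements of the form `[T, 1, U]`. -/
def F : Subgroup C.Thompson where
  carrier := {x | ∃ (n : ℕ) (T U : DaryTree d) (hT : T.numLeaves = n) (hU : U.numLeaves = n),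
    x = C.cls ⟨n, T, 1, U, hT, hU⟩}
  one_mem' := ⟨1, .leaf, .leaf, rfl, rfl, rfl⟩
  mul_mem' := by
    rintro _ _ ⟨n, T, U, hT, hU, rfl⟩ ⟨m, A, B, hA, hB, rfl⟩
    obtain ⟨l, X, Y, Z, g, h, hX, hY, hZ, e1, e2⟩ :=
      exists_align (C := C) ⟨n, T, 1, U, hT, hU⟩ ⟨m, A, 1, B, hA, hB⟩
    have r1 : g = 1 := Expands.g_eq_one C e1 rfl
    have r2 : h = 1 := Expands.g_eq_one C e2 rfl
    subst r1 r2
    exact ⟨l, X, Z, hX, hZ, by rw [e1.cls_eq, e2.cls_eq, cls_mul_cls, one_mul]⟩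
  inv_mem' := by
    rintro _ ⟨n, T, U, hT, hU, rfl⟩
    exact ⟨n, U, T, hU, hT, by rw [cls_inv]; simp [TreeTriple.inv]⟩

end CloningSystem

/-- A group is ICC if the conjugacy class of every non-trivial element is infinite. -/
def IsICC (Γ : Type*) [Group Γ] : Prop := ∀ x : Γ, x ≠ 1 → {y : Γ | IsConj x y}.Infinite

/-- The Hilbert space `ℓ²(Γ)`. -/
abbrev EllTwo (Γ : Type*) : Type _ := lp (fun _ : Γ => ℂ) 2

section GroupVonNeumann

variable {Γ : Type*} [Group Γ]

/-- Left translation `(λ_g ψ)(h) = ψ(g⁻¹ h)` as a linear isometry of `ℓ²(Γ)`. -/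
noncomputable def leftRegularIsometry (g : Γ) : EllTwo Γ →ₗᵢ[ℂ] EllTwo Γ where
  toFun ψ := ⟨fun h => ψ (g⁻¹ * h), by
    have h := lp.memℓp ψ
    change Memℓp (fun h => ψ (g⁻¹ * h)) 2
    rw [memℓp_gen_iff (by simp)] at h ⊢
    exact (Equiv.mulLeft g⁻¹).summable_iff.2 h⟩
  map_add' _ _ := rfl
  map_smul' _ _ := rfl
  norm_map' ψ := by
    rw [lp.norm_eq_tsum_rpow (by simp), lp.norm_eq_tsum_rpow (by simp)]
    congr 1
    exact (Equiv.mulLeft g⁻¹).tsum_eq fun h => ‖ψ h‖ ^ (2 : ℝ≥0∞).toReal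

/-- The left regular representation `λ : Γ → B(ℓ²(Γ))`. -/
noncomputable def leftRegular (g : Γ) : EllTwo Γ →L[ℂ] EllTwo Γ :=
  (leftRegularIsometry g).toContinuousLinearMap

end GroupVonNeumann

section VonNeumann

variable {H : Type*} [NormedAddCommGroup H] [InnerProductSpace ℂ H] [CompleteSpace H]

/-- The von Neumann algebra generated by a set `S` of bounded operators: the double commutant of
`S ∪ S*`. -/
noncomputable def vonNeumannGenerated (S : Set (H →L[ℂ] H)) : VonNeumannAlgebra H where
  toStarSubalgebra :=
    StarSubalgebra.centralizer ℂ (StarSubalgebra.centralizer ℂ S : Set (H →L[ℂ] H))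
  centralizer_centralizer' := by
    have h : ((StarSubalgebra.centralizer ℂ
        (StarSubalgebra.centralizer ℂ S : Set (H →L[ℂ] H)) : StarSubalgebra ℂ (H →L[ℂ] H)) :
          Set (H →L[ℂ] H)) =
        Set.centralizer (Set.centralizer (S ∪ star S)) := by
      rw [StarSubalgebra.coe_centralizer_centralizer]
    change Set.centralizer (Set.centralizer ((StarSubalgebra.centralizer ℂ
        (StarSubalgebra.centralizer ℂ S : Set (H →L[ℂ] H)) : StarSubalgebra ℂ (H →L[ℂ] H)) :
          Set (H →L[ℂ] H))) = ((StarSubalgebra.centralizer ℂ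
        (StarSubalgebra.centralizer ℂ S : Set (H →L[ℂ] H)) : StarSubalgebra ℂ (H →L[ℂ] H)) :
          Set (H →L[ℂ] H))
    rw [h, Set.centralizer_centralizer_centralizer]

/-- The relative commutant `N' ∩ M`. -/
def relativeCommutant (N M : VonNeumannAlgebra H) : Set (H →L[ℂ] H) :=
  {x | x ∈ M ∧ ∀ y ∈ N, y * x = x * y}

/-- An inclusion `N ⊆ M` of von Neumann algebras is irreducible if `N' ∩ M` is the center
`Z(N) = N' ∩ N` of `N`. -/
def IsIrreducibleInclusion (N M : VonNeumannAlgebra H) : Prop :=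
  N ≤ M ∧ relativeCommutant N M = relativeCommutant N N

end VonNeumann

/-- The group von Neumann algebra `L(Γ)`, acting on `ℓ²(Γ)`. -/
noncomputable def groupVonNeumann (Γ : Type*) [Group Γ] : VonNeumannAlgebra (EllTwo Γ) :=
  vonNeumannGenerated (Set.range (leftRegular (Γ := Γ)))

/-- For a subgroup `K` of `Γ`, the canonical copy of `L(K)` inside `L(Γ)`: the von Neumann algebra
generated by the operators `λ_k`, `k ∈ K`, on `ℓ²(Γ)`. -/
noncomputable def subgroupVonNeumann {Γ : Type*} [Group Γ] (K : Subgroup Γ) :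
    VonNeumannAlgebra (EllTwo Γ) :=
  vonNeumannGenerated (leftRegular '' (K : Set Γ))

/-!
Everything rests on the fact that a non-trivial `x` in the Thompson-like group has infinitely many
conjugates under the Higman--Thompson group `F_d`. Suppose that it has only finitely many. Then some
normal subgroup `K` of finite index in `F_d` centralizes `x`, and the proof has two steps.

*The element `x` lies in `F_d`* (`CloningSystem.mem_F_of_finite_conj`). For every sufficiently large
tree `W`, write `x = [A, g_W, W]`. If `[W, 1, W']` lies in `K`, comparing it with its conjugate
`x [W, 1, W'] x⁻¹ = [A, g_W g_{W'}⁻¹, A']` gives `g_W = g_{W'}`. If `W` is a large tree with a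
caret glued to its `k`-th leaf, then `g_W` lies in the image of the `k`-th cloning map. So it suffices to find, for
every `k`, a tree `W_k` with a caret at `k` such that all `W_k` agree modulo `K`; then the common value
`g` of the `g_{W_k}` lies in the image of every cloning map, hence is trivial by diversity. These trees
are constructed in `CloningSystem.exists_trees_mod`: gluing a caret to the `k`-th leaf corresponds to
the generator `x_k` of `F_d`, with relations `x_j x_i = x_i x_{j + d - 1}` for `i < j`. In a quotient of
`F_d` of exponent `N` they give `x_j = x_{j + N (d - 1)}` for `j ≥ 1`, so the caret at `k` can be
cancelled by `N - 1` carets glued beforehand, at `k` or at `k - N (d - 1)`.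

*The group `F_d` is ICC* (`CloningSystem.infinite_conj_of_mem_F`). It acts on infinite words over
`{0, …, d - 1}`, by changing the prefixes that are the leaves of one tree into those of the other. A
non-trivial element `x` maps some `γ` to some `α ≠ γ`, and `γ` can be taken to contain the pattern
`0 1` infinitely often. Elements `f_p` supported near `γ` fix `α` and map to `γ` words `γ_p` that first
differ from `γ` at position `p`; then `f_p⁻¹ x f_p` maps `γ_p` to `α`, so these conjugates are distinct.

For the von Neumann algebras, let `X` lie in `L(F_d)' ∩ L(Γ)`. It commutes with the right regular
representation, so it is determined by `ξ = X δ₁`, which is constant on `F_d`-conjugacy classes because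
`X` commutes with `L(F_d)`. Being square-summable, `ξ` vanishes off the identity, so `X` is a scalar.
-/

/-! ### Trees and infinite words -/

namespace DaryTree

variable {d : ℕ}

/-- Reading an infinite word `α` as a path from the root of `T`: the index of the leaf through which
the path leaves `T`, and the part of `α` that remains to be read there. -/
def exit : DaryTree d → (ℕ → Fin d) → ℕ × (ℕ → Fin d)
  | leaf, α => (0, α)
  | node c, α =>
      (offset c (α 0) + ((c (α 0)).exit fun t => α (t + 1)).1, ((c (α 0)).exit fun t => α (t + 1)).2)

/-- How the data `T.exit α = (j, w)` change when a caret is glued to the `k`-th leaf. -/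
def refineExit (k : ℕ) (p : ℕ × (ℕ → Fin d)) : ℕ × (ℕ → Fin d) :=
  if p.1 < k then p else if p.1 = k then (k + (p.2 0).val, fun t => p.2 (t + 1))
  else (p.1 + (d - 1), p.2)

theorem one_le_numLeaves (hd : 2 ≤ d) (T : DaryTree d) : 1 ≤ T.numLeaves :=
  (Le.leaf T).numLeaves_le hd

theorem offset_add_le_node (c : Fin d → DaryTree d) (i : Fin d) :
    offset c i + (c i).numLeaves ≤ (node c).numLeaves :=
  offset_add_le_sum c i _ (Finset.subset_univ _)

theorem exit_lt (T : DaryTree d) : ∀ α, (T.exit α).1 < T.numLeaves := by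
  induction T with
  | leaf => intro α; simp [exit, numLeaves]
  | node c ih =>
    intro α
    have h1 := ih (α 0) fun t => α (t + 1)
    have h2 := offset_add_le_node c (α 0)
    simp only [exit]
    omega

theorem exit_surjective (T : DaryTree d) :
    ∀ k, k < T.numLeaves → ∀ w, ∃ α, T.exit α = (k, w) := by
  induction T with
  | leaf =>
    intro k hk w
    simp only [numLeaves] at hk
    obtain rfl : k = 0 := by omega
    exact ⟨w, rfl⟩
  | node c ih =>
    intro k hk w
    obtain ⟨i, h1, h2⟩ := exists_child c k hk
    obtain ⟨α, hα⟩ := ih i (k - offset c i) (by omega) w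
    refine ⟨fun t => Nat.casesOn t i α, ?_⟩
    change (offset c i + ((c i).exit α).1, ((c i).exit α).2) = (k, w)
    rw [hα]
    ext1
    · simp only; omega
    · rfl

theorem child_eq_of_index_eq {c : Fin d → DaryTree d} {i j : Fin d} {a b : ℕ}
    (ha : a < (c i).numLeaves) (hb : b < (c j).numLeaves) (h : offset c i + a = offset c j + b) :
    i = j := by
  rcases lt_trichotomy i j with hlt | heq | hlt
  · have := offset_add_le (c := c) hlt
    omega
  · exact heq
  · have := offset_add_le (c := c) hlt
    omega

theorem exit_injective (T : DaryTree d) : ∀ α β, T.exit α = T.exit β → α = β := by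
  induction T with
  | leaf => intro α β h; simpa [exit] using h
  | node c ih =>
    intro α β h
    simp only [exit, Prod.mk.injEq] at h
    obtain ⟨h1, h2⟩ := h
    have h0 : α 0 = β 0 := child_eq_of_index_eq (exit_lt _ _) (exit_lt _ _) h1
    rw [← h0] at h1 h2
    have h3 := ih (α 0) _ _ (Prod.ext (by omega) h2)
    funext t
    cases t with
    | zero => exact h0
    | succ t => exact congrFun h3 t

theorem exists_exit_snd (T : DaryTree d) : ∀ α, ∃ s, (T.exit α).2 = fun t => α (t + s) := by
  induction T with
  | leaf => intro α; exact ⟨0, rfl⟩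
  | node c ih =>
    intro α
    obtain ⟨s, hs⟩ := ih (α 0) fun t => α (t + 1)
    exact ⟨s + 1, hs⟩

theorem exit_addCaret (hd : 2 ≤ d) (T : DaryTree d) : ∀ k, k < T.numLeaves → ∀ α,
    (T.addCaret k).exit α = refineExit k (T.exit α) := by
  induction T with
  | leaf =>
    intro k hk α
    simp only [numLeaves] at hk
    obtain rfl : k = 0 := by omega
    simp [addCaret, exit, refineExit, offset, numLeaves]
  | node c ih =>
    intro k hk α
    obtain ⟨i, h1, h2⟩ := exists_child c k hk
    rw [addCaret_node h1 h2]
    have h3 := exit_lt (c (α 0)) fun t => α (t + 1)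
    rcases lt_trichotomy (α 0) i with h | h | h
    · have := offset_add_le (c := c) h
      simp only [exit, offset_update_of_le c h.le, Function.update_of_ne h.ne]
      rw [refineExit, if_pos (by simp only; omega)]
    · simp only [exit, h, offset_update_of_le c le_rfl, Function.update_self]
      rw [ih i _ (by omega)]
      set p := (c i).exit fun t => α (t + 1)
      simp only [refineExit]
      split_ifs <;> first | omega | (ext1 <;> simp only <;> omega)
    · have e1 := offset_add_le (c := c) h
      have e2 := offset_update_of_lt c h ((c i).addCaret (k - offset c i))
      rw [numLeaves_addCaret hd _ _ (by omega)] at e2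
      simp only [exit, Function.update_of_ne h.ne']
      rw [refineExit, if_neg (by simp only; omega), if_neg (by simp only; omega)]
      ext1
      · simp only; omega
      · rfl

theorem refineExit_injective (k : ℕ) : Function.Injective (refineExit (d := d) k) := by
  rintro ⟨a, v⟩ ⟨b, w⟩ h
  have hv := (v 0).2
  have hw := (w 0).2
  simp only [refineExit] at h
  split_ifs at h with h1 h2 h3 h4 h5 h6 <;> simp only [Prod.mk.injEq] at h ⊢ <;>
    obtain ⟨h', h''⟩ := h
  all_goals first | exact ⟨by omega, h''⟩ | omega | skip
  refine ⟨by omega, funext fun t => ?_⟩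
  cases t with
  | zero => exact Fin.ext (by omega)
  | succ t => exact congrFun h'' t

/-- The words in which the pattern `0 1` occurs infinitely often. They form a tail-invariant set that
meets every cone, and avoid the eventually constant words, where the germs of elements of the
Higman--Thompson group are special. -/
def IsRecurrent (α : ℕ → Fin d) : Prop :=
  ∀ s, ∃ p, s ≤ p ∧ (α p).val = 0 ∧ (α (p + 1)).val = 1

theorem isRecurrent_of_tail {α : ℕ → Fin d} {s : ℕ} (h : IsRecurrent fun t => α (t + s)) :
    IsRecurrent α := by
  intro r
  obtain ⟨p, hp, h0, h1⟩ := h r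
  exact ⟨p + s, by omega, h0, by rw [add_right_comm]; exact h1⟩

theorem exists_isRecurrent (hd : 2 ≤ d) : ∃ α : ℕ → Fin d, IsRecurrent α := by
  refine ⟨fun t => ⟨t % 2, by omega⟩, fun s => ⟨2 * s, by omega, ?_, ?_⟩⟩ <;> simp only <;> omega

theorem exists_isRecurrent_exit_eq (hd : 2 ≤ d) (T : DaryTree d) (k : ℕ) (hk : k < T.numLeaves) :
    ∃ α, IsRecurrent α ∧ (T.exit α).1 = k := by
  obtain ⟨w, hw⟩ := exists_isRecurrent hd
  obtain ⟨α, hα⟩ := exit_surjective T k hk w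
  obtain ⟨s, hs⟩ := exists_exit_snd T α
  rw [hα] at hs
  simp only at hs
  rw [hs] at hw
  exact ⟨α, isRecurrent_of_tail hw, by rw [hα]⟩

theorem isRecurrent_cons (i : Fin d) {α : ℕ → Fin d} (h : IsRecurrent α) :
    IsRecurrent (fun t => Nat.casesOn t i α : ℕ → Fin d) :=
  isRecurrent_of_tail (s := 1) h

/-- A tree is determined by the leaves through which the recurrent words leave it. -/
theorem eq_of_exit_eq (hd : 2 ≤ d) (T : DaryTree d) : ∀ U : DaryTree d,
    (∀ α, IsRecurrent α → (T.exit α).1 = (U.exit α).1) → T = U := by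
  have aux : ∀ c : Fin d → DaryTree d, ∃ α, IsRecurrent α ∧ ((node c).exit α).1 ≠ 0 := by
    intro c
    obtain ⟨α, h1, h2⟩ := exists_isRecurrent_exit_eq hd (node c) 1 (by
      have h1 := offset_add_le_node c ⟨1, by omega⟩
      have h2 := offset_add_le (c := c) (i := ⟨0, by omega⟩) (j := ⟨1, by omega⟩) (by simp)
      have h3 := one_le_numLeaves hd (c ⟨0, by omega⟩)
      have h4 := one_le_numLeaves hd (c ⟨1, by omega⟩)
      omega)
    exact ⟨α, h1, by omega⟩
  induction T with
  | leaf =>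
    intro U h
    cases U with
    | leaf => rfl
    | node c =>
      obtain ⟨α, h1, h2⟩ := aux c
      exact absurd (h α h1).symm h2
  | node c ih =>
    intro U h
    cases U with
    | leaf =>
      obtain ⟨α, h1, h2⟩ := aux c
      exact absurd (h α h1) h2
    | node c' =>
      congr 1
      funext i
      have key : ∀ α, IsRecurrent α →
          offset c i + ((c i).exit α).1 = offset c' i + ((c' i).exit α).1 :=
        fun α hα => h _ (isRecurrent_cons i hα)
      -- The leftmost leaf of the `i`-th subtree has index `offset c i`, so the offsets agree.
      obtain ⟨α, hα, h0⟩ := exists_isRecurrent_exit_eq hd (c i) 0 (one_le_numLeaves hd _)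
      obtain ⟨α', hα', h0'⟩ := exists_isRecurrent_exit_eq hd (c' i) 0 (one_le_numLeaves hd _)
      have e1 := key α hα
      have e2 := key α' hα'
      refine ih i _ fun β hβ => ?_
      have e3 := key β hβ
      omega

/-- The complete `d`-ary tree of depth `p`. -/
def complete (d : ℕ) : ℕ → DaryTree d
  | 0 => leaf
  | p + 1 => node fun _ => complete d p

theorem exit_complete_snd (p : ℕ) : ∀ α, ((complete d p).exit α).2 = fun t => α (t + p) := by
  induction p with
  | zero => intro α; rfl
  | succ p ih => intro α; simp only [complete, exit, ih]; rfl

theorem eq_of_exit_complete_fst_eq (p : ℕ) : ∀ α β : ℕ → Fin d,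
    ((complete d p).exit α).1 = ((complete d p).exit β).1 → ∀ t < p, α t = β t := by
  induction p with
  | zero => intro α β _ t ht; omega
  | succ p ih =>
    intro α β h t ht
    simp only [complete, exit] at h
    have h0 : α 0 = β 0 := child_eq_of_index_eq (c := fun _ => complete d p)
      (exit_lt _ _) (exit_lt _ _) h
    cases t with
    | zero => exact h0
    | succ t =>
      rw [← h0] at h
      exact ih _ _ (Nat.add_left_cancel h) t (by omega)

end DaryTree

/-! ### The Higman--Thompson group and its action on infinite words -/

namespace CloningSystem

open DaryTree

variable {d : ℕ} {G : ℕ → Type*} [∀ n, Group (G n)] (C : CloningSystem d G)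

/-- The element `[T, 1, U]` of the Higman--Thompson group. -/
def frac (T U : DaryTree d) (h : T.numLeaves = U.numLeaves) : C.F :=
  ⟨C.cls ⟨U.numLeaves, T, 1, U, h, rfl⟩, _, T, U, h, rfl, rfl⟩

theorem cls_eq_frac {n : ℕ} (T U : DaryTree d) (hT : T.numLeaves = n) (hU : U.numLeaves = n) :
    C.cls ⟨n, T, 1, U, hT, hU⟩ = C.frac T U (hT.trans hU.symm) := by
  subst hU
  rfl

theorem frac_mul (T U W : DaryTree d) (h : T.numLeaves = U.numLeaves)
    (h' : U.numLeaves = W.numLeaves) :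
    C.frac T U h * C.frac U W h' = C.frac T W (h.trans h') := by
  apply Subtype.ext
  rw [Subgroup.coe_mul, ← cls_eq_frac C T U (h.trans h') h', ← cls_eq_frac C U W h' rfl,
    ← cls_eq_frac C T W (h.trans h') rfl, cls_mul_cls, one_mul]

theorem frac_self (T : DaryTree d) : C.frac T T rfl = 1 := by
  have h := C.frac_mul T T T rfl rfl
  simpa using h

theorem frac_inv (T U : DaryTree d) (h : T.numLeaves = U.numLeaves) :
    (C.frac T U h)⁻¹ = C.frac U T h.symm := by
  rw [inv_eq_iff_mul_eq_one, frac_mul, frac_self]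

theorem frac_addCaret (T U : DaryTree d) (h : T.numLeaves = U.numLeaves) (k : ℕ)
    (hk : k < U.numLeaves) (h' : (T.addCaret k).numLeaves = (U.addCaret k).numLeaves) :
    C.frac (T.addCaret k) (U.addCaret k) h' = C.frac T U h := by
  have e := cls_expand C ⟨U.numLeaves, T, 1, U, h, rfl⟩ ⟨k, hk⟩
  apply Subtype.ext
  rw [← cls_eq_frac C T U h rfl, ← e]
  simp only [expand, κ_one, map_one, Equiv.Perm.coe_one, id_eq]
  rw [cls_eq_frac]

variable {C}

/-- Being of the form `[T, 1, U]` is not only preserved but also reflected by expansions. -/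
theorem Expands.g_eq_one_iff {a b : TreeTriple d G} (h : C.Expands a b) : a.g = 1 ↔ b.g = 1 := by
  refine ⟨h.g_eq_one C, ?_⟩
  induction h with
  | refl => exact id
  | @tail b _ _ h ih =>
    obtain ⟨k, rfl⟩ := h
    intro h1
    exact ih (C.κ_injective _ k (h1.trans (C.κ_one _ k).symm))

theorem eq_one_of_cls_mem_F {a : TreeTriple d G} (h : C.cls a ∈ C.F) : a.g = 1 := by
  obtain ⟨n, T, U, hT, hU, h⟩ := h
  obtain ⟨c, h1, h2⟩ := cls_eq_iff.1 h
  exact h1.g_eq_one_iff.2 (h2.g_eq_one_iff.1 rfl)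

/-- The action of the Higman--Thompson group on infinite words, as a relation: `[T, 1, U]` maps `β`
to `α` if, for some `j`, it is obtained from `β` by replacing the path to the `j`-th leaf of `U` by
the path to the `j`-th leaf of `T`. -/
def MapsWord (x : C.Thompson) (α β : ℕ → Fin d) : Prop :=
  ∃ (n : ℕ) (T U : DaryTree d) (hT : T.numLeaves = n) (hU : U.numLeaves = n),
    x = C.cls ⟨n, T, 1, U, hT, hU⟩ ∧ T.exit α = U.exit β

theorem Expands.exit_eq_iff {a b : TreeTriple d G} (h : C.Expands a b) (ha : a.g = 1)
    (α β : ℕ → Fin d) : a.T.exit α = a.U.exit β ↔ b.T.exit α = b.U.exit β := by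
  induction h with
  | refl => rfl
  | @tail b _ h' h ih =>
    obtain ⟨k, rfl⟩ := h
    have h1 : b.g = 1 := Expands.g_eq_one C h' ha
    simp only [expand, h1, map_one, Equiv.Perm.coe_one, id_eq]
    rw [ih, exit_addCaret C.two_le _ _ (by rw [b.hT]; exact k.2),
      exit_addCaret C.two_le _ _ (by rw [b.hU]; exact k.2), (refineExit_injective _).eq_iff]

theorem mapsWord_cls_iff {n : ℕ} {T U : DaryTree d} (hT : T.numLeaves = n) (hU : U.numLeaves = n)
    (α β : ℕ → Fin d) :
    MapsWord (C.cls ⟨n, T, 1, U, hT, hU⟩) α β ↔ T.exit α = U.exit β := by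
  constructor
  · rintro ⟨n', T', U', hT', hU', h, h'⟩
    obtain ⟨c, h1, h2⟩ := cls_eq_iff.1 h
    exact (h1.exit_eq_iff rfl α β).2 ((h2.exit_eq_iff rfl α β).1 h')
  · exact fun h => ⟨n, T, U, hT, hU, rfl, h⟩

theorem mapsWord_frac_iff {T U : DaryTree d} (h : T.numLeaves = U.numLeaves) (α β : ℕ → Fin d) :
    MapsWord (C.frac T U h : C.Thompson) α β ↔ T.exit α = U.exit β :=
  mapsWord_cls_iff h rfl α β

theorem MapsWord.inv {x : C.Thompson} {α β : ℕ → Fin d} (h : MapsWord x α β) :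
    MapsWord x⁻¹ β α := by
  obtain ⟨n, T, U, hT, hU, rfl, h⟩ := h
  exact ⟨n, U, T, hU, hT, by rw [cls_inv]; simp [TreeTriple.inv], h.symm⟩

theorem MapsWord.mul {x y : C.Thompson} {α β γ : ℕ → Fin d} (h : MapsWord x α β)
    (h' : MapsWord y β γ) : MapsWord (x * y) α γ := by
  have hx : x ∈ C.F := by
    obtain ⟨n, T, U, hT, hU, e, -⟩ := h
    exact ⟨n, T, U, hT, hU, e⟩
  have hy : y ∈ C.F := by
    obtain ⟨n, T, U, hT, hU, e, -⟩ := h'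
    exact ⟨n, T, U, hT, hU, e⟩
  obtain ⟨n, T, U, W, g, g', hT, hU, hW, rfl, rfl⟩ := ind_align C x y
  obtain rfl : g = 1 := eq_one_of_cls_mem_F hx
  obtain rfl : g' = 1 := eq_one_of_cls_mem_F hy
  rw [cls_mul_cls, one_mul]
  rw [mapsWord_cls_iff] at h h' ⊢
  exact h.trans h'

theorem MapsWord.right_unique {x : C.Thompson} {α β β' : ℕ → Fin d} (h : MapsWord x α β)
    (h' : MapsWord x α β') : β = β' := by
  obtain ⟨n, T, U, hT, hU, rfl, h⟩ := h
  rw [mapsWord_cls_iff] at h'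
  exact exit_injective U _ _ (h.symm.trans h')

/-- Let `γ` be a word with `γ p = 0` and `γ (p + 1) = 1`, and `α` a word that differs from `γ` before
position `p`. Then some element of the Higman--Thompson group fixes `α` and maps to `γ` a word that
first differs from `γ` at position `p`. -/
theorem exists_mapsWord_of_digits {α γ : ℕ → Fin d} {p : ℕ} (hp : ∃ t < p, α t ≠ γ t)
    (h0 : (γ p).val = 0) (h1 : (γ (p + 1)).val = 1) :
    ∃ f ∈ C.F, ∃ γ' : ℕ → Fin d, MapsWord f α α ∧ MapsWord f γ γ' ∧ (∀ t < p, γ' t = γ t) ∧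
      γ' p ≠ γ p := by
  have hd := C.two_le
  have hk := exit_lt (complete d p) γ
  have hne : ((complete d p).exit α).1 ≠ ((complete d p).exit γ).1 := by
    intro h
    obtain ⟨t, ht, h'⟩ := hp
    exact h' (eq_of_exit_complete_fst_eq p _ _ h t ht)
  set k := ((complete d p).exit γ).1 with hkdef
  -- Below the `k`-th leaf of the complete tree, the element maps the cone `1 0` to the cone `0 1`.
  have e0 := numLeaves_addCaret hd _ _ hk
  have eA := numLeaves_addCaret hd ((complete d p).addCaret k) k (by omega)
  have eB := numLeaves_addCaret hd ((complete d p).addCaret k) (k + 1) (by omega)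
  have hγ := exit_complete_snd p γ
  obtain ⟨γ', hγ'⟩ := exit_surjective (complete d p) k hk
    (fun t => if t = 0 then γ (p + 1) else if t = 1 then γ p else γ (t + p))
  have hγ'2 := exit_complete_snd p γ'
  rw [hγ'] at hγ'2
  refine ⟨_, (C.frac (((complete d p).addCaret k).addCaret k)
    (((complete d p).addCaret k).addCaret (k + 1)) (eA.trans eB.symm)).2, γ', ?_, ?_, ?_, ?_⟩
  · rw [mapsWord_frac_iff, exit_addCaret hd _ _ (by omega), exit_addCaret hd _ _ hk,
      exit_addCaret hd _ _ (by omega), exit_addCaret hd _ _ hk]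
    simp only [refineExit]
    split_ifs <;> simp_all <;> omega
  · rw [mapsWord_frac_iff, exit_addCaret hd _ _ (by omega), exit_addCaret hd _ _ hk,
      exit_addCaret hd _ _ (by omega), exit_addCaret hd _ _ hk, hγ',
      show (complete d p).exit γ = (k, fun t => γ (t + p)) from Prod.ext hkdef.symm hγ]
    have h1' : (γ (1 + p)).val = 1 := by rw [add_comm]; exact h1
    simp [refineExit, h0, h1, h1']
  · exact fun t ht => eq_of_exit_complete_fst_eq p _ _ (by rw [hγ']) t ht
  · have := congrFun hγ'2 0
    simp only [if_true, zero_add] at this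
    rw [← this]
    intro h
    have := congrArg Fin.val h
    omega

/-- The Higman--Thompson group is ICC. A non-trivial `x` maps some recurrent word `γ` to a word
`α ≠ γ`; conjugating by elements that fix `α` and move `γ` by ever smaller amounts gives infinitely
many elements that map different words to `α`. -/
theorem infinite_conj_of_mem_F {x : C.Thompson} (hx : x ∈ C.F) (hx1 : x ≠ 1) :
    {y : C.Thompson | ∃ f ∈ C.F, y = f⁻¹ * x * f}.Infinite := by
  obtain ⟨n, T, U, hT, hU, rfl⟩ := hx
  have hTU : T ≠ U := by
    rintro rfl
    exact hx1 (cls_one C n T hT)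
  obtain ⟨γ, hγ, hne⟩ : ∃ γ, IsRecurrent γ ∧ (T.exit γ).1 ≠ (U.exit γ).1 := by
    by_contra! h
    exact hTU (eq_of_exit_eq C.two_le T U h)
  obtain ⟨α, hα⟩ := exit_surjective T (U.exit γ).1
    (by rw [hT, ← hU]; exact exit_lt U γ) (U.exit γ).2
  obtain ⟨q, hq⟩ : ∃ q, α q ≠ γ q := by
    by_contra! h
    obtain rfl : α = γ := funext h
    exact hne (by rw [hα])
  choose p hp h0 h1 using fun s => hγ (q + 1 + s)
  choose f hf γ' hfα hfγ hlt hat using fun s =>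
    exists_mapsWord_of_digits (C := C) (α := α) ⟨q, by have := hp s; omega, hq⟩ (h0 s) (h1 s)
  have hmaps : ∀ s, MapsWord ((f s)⁻¹ * C.cls ⟨n, T, 1, U, hT, hU⟩ * f s) α (γ' s) := fun s =>
    ((hfα s).inv.mul ((mapsWord_cls_iff hT hU α γ).2 hα)).mul (hfγ s)
  have hpinf : (Set.range p).Infinite := by
    refine Set.infinite_of_not_bddAbove ?_
    rintro ⟨B, hB⟩
    have h2 := hB ⟨B, rfl⟩
    have := hp B
    omega
  refine Set.infinite_of_injOn_mapsTo (f := fun v => (f (p.invFun v))⁻¹ *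
    C.cls ⟨n, T, 1, U, hT, hU⟩ * f (p.invFun v)) ?_
    (fun v _ => ⟨f (p.invFun v), hf _, rfl⟩) hpinf
  intro v hv w hw h
  have hv' : p (p.invFun v) = v := Function.invFun_eq hv
  have hw' : p (p.invFun w) = w := Function.invFun_eq hw
  have h1 := hmaps (p.invFun v)
  have h2 := hmaps (p.invFun w)
  have e : γ' (p.invFun v) = γ' (p.invFun w) := by
    simp only at h
    rw [h] at h1
    exact h1.right_unique h2
  -- The position at which a word first differs from `γ` can be read off from the word.
  rcases lt_trichotomy v w with hlt' | heq | hlt'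
  · have h3 := hlt (p.invFun w) v (by omega)
    have h4 := hat (p.invFun v)
    rw [hv', e] at h4
    exact absurd h3 h4
  · exact heq
  · have h3 := hlt (p.invFun v) w (by omega)
    have h4 := hat (p.invFun w)
    rw [hw', ← e] at h4
    exact absurd h3 h4

end CloningSystem

/-- If `x` has finitely many conjugates under `K`, some normal subgroup of finite index of `K`
centralizes `x`. -/
theorem Subgroup.exists_normal_finiteIndex_commute {Γ : Type*} [Group Γ] (K : Subgroup Γ)
    (x : Γ) (h : {y : Γ | ∃ f ∈ K, y = f⁻¹ * x * f}.Finite) :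
    ∃ N : Subgroup K, N.Normal ∧ N.FiniteIndex ∧ ∀ f ∈ N, Commute (f : Γ) x := by
  let S : Subgroup K := (Subgroup.centralizer {x}).subgroupOf K
  have hS : ∀ f : K, f ∈ S ↔ x * (f : Γ) = f * x := by
    intro f
    simp [S, Subgroup.mem_subgroupOf, Subgroup.mem_centralizer_singleton_iff, eq_comm]
  have : Finite {y : Γ | ∃ f ∈ K, y = f⁻¹ * x * f} := h
  have : Finite (K ⧸ S) := by
    refine Finite.of_injective (β := {y : Γ | ∃ f ∈ K, y = f⁻¹ * x * f})
      (fun q => ⟨(q.out : Γ) * x * (q.out : Γ)⁻¹, (q.out : Γ)⁻¹, K.inv_mem q.out.2, by simp⟩) ?_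
    intro p q hpq
    simp only [Subtype.mk.injEq] at hpq
    rw [← p.out_eq', ← q.out_eq', QuotientGroup.eq, hS]
    push_cast
    have := congrArg (fun y => (p.out : Γ)⁻¹ * y * (q.out : Γ)) hpq
    simpa [mul_assoc] using this
  have : S.FiniteIndex := Subgroup.finiteIndex_of_finite_quotient
  exact ⟨S.normalCore, inferInstance, inferInstance,
    fun f hf => ((hS f).1 (S.normalCore_le hf)).symm⟩

/-! ### Combs and iterated carets -/

namespace DaryTree

variable {d : ℕ}

/-- The right comb with `n` carets, whose `n`-th caret is glued to its last leaf. -/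
def comb (d : ℕ) : ℕ → DaryTree d
  | 0 => leaf
  | n + 1 => (comb d n).addCaret (n * (d - 1))

/-- `T.addCarets k s` is obtained from `T` by gluing `s` carets, one after the other, to what is the
`k`-th leaf at that moment. -/
def addCarets (T : DaryTree d) (k : ℕ) : ℕ → DaryTree d
  | 0 => T
  | s + 1 => (T.addCarets k s).addCaret k

/-- `T.addLastCarets n s` is obtained from a tree `T` with `n` carets by gluing `s` carets, one after
the other, to what is the last leaf at that moment. -/
def addLastCarets (T : DaryTree d) (n : ℕ) : ℕ → DaryTree d
  | 0 => T
  | s + 1 => (T.addLastCarets n s).addCaret ((n + s) * (d - 1))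

theorem numLeaves_addCaret_eq (hd : 2 ≤ d) {T : DaryTree d} {n k : ℕ}
    (hT : T.numLeaves = n * (d - 1) + 1) (hk : k ≤ n * (d - 1)) :
    (T.addCaret k).numLeaves = (n + 1) * (d - 1) + 1 := by
  rw [numLeaves_addCaret hd T k (by omega), hT]
  ring

theorem numLeaves_comb (hd : 2 ≤ d) (n : ℕ) : (comb d n).numLeaves = n * (d - 1) + 1 := by
  induction n with
  | zero => simp [comb, numLeaves]
  | succ n ih => exact numLeaves_addCaret_eq hd ih le_rfl

theorem numLeaves_addCarets (hd : 2 ≤ d) {T : DaryTree d} {n k : ℕ}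
    (hT : T.numLeaves = n * (d - 1) + 1) (hk : k ≤ n * (d - 1)) (s : ℕ) :
    (T.addCarets k s).numLeaves = (n + s) * (d - 1) + 1 := by
  induction s with
  | zero => exact hT
  | succ s ih =>
    exact numLeaves_addCaret_eq hd ih (hk.trans (Nat.mul_le_mul_right _ (n.le_add_right s)))

theorem numLeaves_addLastCarets (hd : 2 ≤ d) {T : DaryTree d} {n : ℕ}
    (hT : T.numLeaves = n * (d - 1) + 1) (s : ℕ) :
    (T.addLastCarets n s).numLeaves = (n + s) * (d - 1) + 1 := by
  induction s with
  | zero => exact hT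
  | succ s ih => exact numLeaves_addCaret_eq hd ih le_rfl

theorem Le.addCarets (T : DaryTree d) (k s : ℕ) : T.Le (T.addCarets k s) := by
  induction s with
  | zero => exact .refl _
  | succ s ih => exact ih.trans (.addCaret _ _)

theorem Le.addLastCarets (T : DaryTree d) (n s : ℕ) : T.Le (T.addLastCarets n s) := by
  induction s with
  | zero => exact .refl _
  | succ s ih => exact ih.trans (.addCaret _ _)

theorem exists_numLeaves_eq (hd : 2 ≤ d) (T : DaryTree d) :
    ∃ n, T.numLeaves = n * (d - 1) + 1 := by
  induction T with
  | leaf => exact ⟨0, by simp [numLeaves]⟩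
  | node c ih =>
    choose n hn using ih
    refine ⟨∑ i, n i + 1, ?_⟩
    simp only [numLeaves, hn, Finset.sum_add_distrib, ← Finset.sum_mul, Finset.sum_const,
      Finset.card_univ, Fintype.card_fin, smul_eq_mul, mul_one, add_mul, one_mul]
    omega

end DaryTree

/-! ### Generators of the Higman--Thompson group -/

namespace CloningSystem

open DaryTree

variable {d : ℕ} {G : ℕ → Type*} [∀ n, Group (G n)] (C : CloningSystem d G)

/-- The generator `x_k = [R_{n,k}, 1, R_{n+1}]` of the Higman--Thompson group, where `R_n` is the right
comb with `n` carets and `R_{n,k}` is `R_n` with a caret glued to its `k`-th leaf; this does not depend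
on `n` as long as the `k`-th leaf of `R_n` is not the last one (see `frac_comb_eq_gen`). -/
def gen (k : ℕ) : C.F :=
  C.frac ((comb d (k + 1)).addCaret k) (comb d (k + 2)) (by
    rw [numLeaves_comb C.two_le]
    refine numLeaves_addCaret_eq C.two_le (numLeaves_comb C.two_le _) ?_
    exact k.le_succ.trans (Nat.le_mul_of_pos_right _ (by have := C.two_le; omega)))

theorem frac_comb_eq_gen (n k : ℕ) (hk : k < n * (d - 1))
    (h : ((comb d n).addCaret k).numLeaves = (comb d (n + 1)).numLeaves) :
    C.frac ((comb d n).addCaret k) (comb d (n + 1)) h = C.gen k := by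
  have hd := C.two_le
  have hN : ∀ n, k < n * (d - 1) →
      ((comb d n).addCaret k).numLeaves = (comb d (n + 1)).numLeaves := fun n hn => by
    rw [numLeaves_comb hd, numLeaves_addCaret_eq hd (numLeaves_comb hd n) hn.le]
  -- The value for `n + 1` is obtained from the one for `n` by gluing carets to the last leaves.
  have step : ∀ n (hn : k < n * (d - 1)) (hn' : k < (n + 1) * (d - 1)),
      C.frac ((comb d (n + 1)).addCaret k) (comb d (n + 1 + 1)) (hN _ hn') =
        C.frac ((comb d n).addCaret k) (comb d (n + 1)) (hN _ hn) := by
    intro n hn hn'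
    have e : (comb d (n + 1)).addCaret k =
        ((comb d n).addCaret k).addCaret ((n + 1) * (d - 1)) := by
      change ((comb d n).addCaret (n * (d - 1))).addCaret k = _
      rw [addCaret_comm hd _ _ _ hn (by rw [numLeaves_comb hd]; omega), add_mul, one_mul]
    rw [← C.frac_addCaret ((comb d n).addCaret k) (comb d (n + 1)) (hN _ hn) ((n + 1) * (d - 1))
      (by rw [numLeaves_comb hd]; omega) (by rw [← e]; exact hN _ hn')]
    congr 1
  have all : ∀ m n (hn : k < n * (d - 1)) (hn' : k < (n + m) * (d - 1)),
      C.frac ((comb d (n + m)).addCaret k) (comb d (n + m + 1)) (hN _ hn') =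
        C.frac ((comb d n).addCaret k) (comb d (n + 1)) (hN _ hn) := by
    intro m
    induction m with
    | zero => intro n hn hn'; rfl
    | succ m ih =>
      intro n hn hn'
      have : k < (n + m) * (d - 1) := hn.trans_le (Nat.mul_le_mul_right _ (by omega))
      rw [← ih n hn this]
      exact step (n + m) this hn'
  have hk' : k < (k + 1) * (d - 1) :=
    k.lt_succ_self.trans_le (Nat.le_mul_of_pos_right _ (by omega))
  have all' : ∀ n n' (hn : k < n * (d - 1)) (hn' : k < n' * (d - 1)), n ≤ n' →
      C.frac ((comb d n').addCaret k) (comb d (n' + 1)) (hN _ hn') =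
        C.frac ((comb d n).addCaret k) (comb d (n + 1)) (hN _ hn) := by
    intro n n' hn hn' hle
    obtain ⟨m, rfl⟩ := Nat.exists_eq_add_of_le hle
    exact all m n hn hn'
  rcases le_total n (k + 1) with hle | hle
  · exact (all' n (k + 1) hk hk' hle).symm
  · exact all' (k + 1) n hk' hk hle

/-- Relative to the right combs, gluing a caret to a leaf `k` other than the last one multiplies a tree
by the generator `x_k`. -/
theorem frac_addCaret_comb {T : DaryTree d} {n k : ℕ} (hk : k < n * (d - 1))
    (h : T.numLeaves = (comb d n).numLeaves)
    (h' : (T.addCaret k).numLeaves = (comb d (n + 1)).numLeaves) :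
    C.frac (T.addCaret k) (comb d (n + 1)) h' = C.frac T (comb d n) h * C.gen k := by
  have hd := C.two_le
  have h1 : ((comb d n).addCaret k).numLeaves = (comb d (n + 1)).numLeaves := by
    rw [numLeaves_comb hd, numLeaves_addCaret_eq hd (numLeaves_comb hd n) hk.le]
  rw [← C.frac_comb_eq_gen n k hk h1, ← C.frac_addCaret T (comb d n) h k
    (by rw [numLeaves_comb hd]; omega) (h'.trans h1.symm), frac_mul]

/-- Gluing a caret to the last leaf changes nothing relative to the right combs. -/
theorem frac_addCaret_comb_last {T : DaryTree d} {n : ℕ}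
    (h : T.numLeaves = (comb d n).numLeaves)
    (h' : (T.addCaret (n * (d - 1))).numLeaves = (comb d (n + 1)).numLeaves) :
    C.frac (T.addCaret (n * (d - 1))) (comb d (n + 1)) h' = C.frac T (comb d n) h :=
  C.frac_addCaret T (comb d n) h _ (by rw [numLeaves_comb C.two_le]; omega) h'

theorem frac_addCarets_comb {T : DaryTree d} {n k : ℕ} (hk : k < n * (d - 1))
    (h : T.numLeaves = (comb d n).numLeaves) (s : ℕ)
    (h' : (T.addCarets k s).numLeaves = (comb d (n + s)).numLeaves) :
    C.frac (T.addCarets k s) (comb d (n + s)) h' = C.frac T (comb d n) h * C.gen k ^ s := by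
  have hd := C.two_le
  induction s with
  | zero => rw [pow_zero, mul_one]; rfl
  | succ s ih =>
    have h1 : (T.addCarets k s).numLeaves = (comb d (n + s)).numLeaves := by
      rw [numLeaves_comb hd, numLeaves_addCarets hd (h.trans (numLeaves_comb hd n)) hk.le]
    rw [pow_succ, ← mul_assoc, ← ih h1]
    exact C.frac_addCaret_comb (hk.trans_le (Nat.mul_le_mul_right _ (by omega))) h1 h'

theorem frac_addLastCarets_comb {T : DaryTree d} {n : ℕ}
    (h : T.numLeaves = (comb d n).numLeaves) (s : ℕ)
    (h' : (T.addLastCarets n s).numLeaves = (comb d (n + s)).numLeaves) :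
    C.frac (T.addLastCarets n s) (comb d (n + s)) h' = C.frac T (comb d n) h := by
  have hd := C.two_le
  induction s with
  | zero => rfl
  | succ s ih =>
    have h1 : (T.addLastCarets n s).numLeaves = (comb d (n + s)).numLeaves := by
      rw [numLeaves_comb hd, numLeaves_addLastCarets hd (h.trans (numLeaves_comb hd n))]
    rw [← ih h1]
    exact C.frac_addCaret_comb_last h1 h'

/-- The defining relations of the Higman--Thompson group; they say that carets glued to different leaves
commute. -/
theorem gen_mul_gen {i j : ℕ} (hij : i < j) :
    C.gen j * C.gen i = C.gen i * C.gen (j + (d - 1)) := by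
  have hd := C.two_le
  have hj : j < (j + 1) * (d - 1) :=
    j.lt_succ_self.trans_le (Nat.le_mul_of_pos_right _ (by omega))
  have hj' : (j + 1 + 1) * (d - 1) = (j + 1) * (d - 1) + (d - 1) := by ring
  have h0 := numLeaves_comb hd (j + 1)
  have hi := numLeaves_addCaret_eq hd h0 (k := i) (by omega)
  have hjl := numLeaves_addCaret_eq hd h0 (k := j) (by omega)
  have hji := numLeaves_addCaret_eq hd hjl (k := i) (by omega)
  have hij' := numLeaves_addCaret_eq hd hi (k := j + (d - 1)) (by omega)
  have e := addCaret_comm hd (comb d (j + 1)) i j hij (by omega)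
  have r1 := C.frac_addCaret_comb (T := comb d (j + 1)) hj rfl (by rw [hjl, numLeaves_comb hd])
  have r2 := C.frac_addCaret_comb (k := i) (n := j + 1 + 1) (by omega)
    (by rw [hjl, numLeaves_comb hd]) (by rw [hji, numLeaves_comb hd])
  have r3 := C.frac_addCaret_comb (T := comb d (j + 1)) (hij.trans hj) rfl
    (by rw [hi, numLeaves_comb hd])
  have r4 := C.frac_addCaret_comb (k := j + (d - 1)) (n := j + 1 + 1) (by omega)
    (by rw [hi, numLeaves_comb hd]) (by rw [hij', numLeaves_comb hd])
  rw [r1, frac_self, one_mul] at r2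
  rw [r3, frac_self, one_mul] at r4
  rw [← r2, ← r4]
  congr 1

theorem gen_mul_gen_zero_pow {j : ℕ} (hj : 1 ≤ j) (s : ℕ) :
    C.gen j * C.gen 0 ^ s = C.gen 0 ^ s * C.gen (j + s * (d - 1)) := by
  induction s with
  | zero => simp
  | succ s ih =>
    rw [pow_succ, ← mul_assoc, ih, mul_assoc, C.gen_mul_gen (by omega), ← mul_assoc, add_assoc,
      add_mul, one_mul]

variable {C}

/-! ### Elements with finitely many `F_d`-conjugates -/

/-- If `[W, 1, W']` commutes with `x = [A, g, W] = [A', g', W']`, the group elements `g` and `g'` are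
equal: conjugating `[W, 1, W']` with `x` gives `[A, g g'⁻¹, A']`. -/
theorem eq_of_commute_frac {x : C.Thompson} {n : ℕ} {A A' W W' : DaryTree d} {g g' : G n}
    (hA : A.numLeaves = n) (hW : W.numLeaves = n) (hA' : A'.numLeaves = n)
    (hW' : W'.numLeaves = n) (hx : C.cls ⟨n, A, g, W, hA, hW⟩ = x)
    (hx' : C.cls ⟨n, A', g', W', hA', hW'⟩ = x)
    (h : Commute (C.frac W W' (hW.trans hW'.symm) : C.Thompson) x) : g = g' := by
  have e : C.cls ⟨n, A, g * 1 * g'⁻¹, A', hA, hA'⟩ =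
      x * (C.frac W W' (hW.trans hW'.symm) : C.Thompson) * x⁻¹ := by
    rw [← cls_mul_cls C n A W' A' (g * 1) g'⁻¹ hA hW' hA', ← cls_mul_cls C n A W W' g 1 hA hW hW',
      hx, ← hx', cls_inv, cls_eq_frac C W W' hW hW']
    rfl
  rw [← h.eq, mul_inv_cancel_right] at e
  have h1 := eq_one_of_cls_mem_F (a := ⟨n, A, g * 1 * g'⁻¹, A', hA, hA'⟩) (by
    rw [e]
    exact SetLike.coe_mem _)
  rw [mul_one] at h1
  exact mul_inv_eq_one.1 h1

/-- Large trees `W_j` with a caret at position `j`, for all possible `j`, that agree modulo a given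
normal subgroup of finite index of the Higman--Thompson group. Modulo the subgroup the generators satisfy
`x_r ^ (N + 1) = 1` and `x_j = x_{j + (N + 1) (d - 1)}` for `j ≥ 1`, so that a caret at position `j` is
compensated by `N` carets glued beforehand, at `j` or at `j - (N + 1) (d - 1)`. -/
theorem exists_trees_mod (K : Subgroup C.F) [K.Normal] [K.FiniteIndex] {U : DaryTree d} {n N : ℕ}
    (hU : U.numLeaves = n * (d - 1) + 1) (hN : ∀ f : C.F, f ^ (N + 1) ∈ K) (hn : N + 2 ≤ n) :
    ∃ V : ℕ → DaryTree d, ∀ j ≤ (n + N) * (d - 1), U.Le (V j) ∧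
      (V j).numLeaves = (n + N) * (d - 1) + 1 ∧
      ∃ h, ((C.frac U (comb d n) (hU.trans (numLeaves_comb C.two_le n).symm))⁻¹ *
        C.frac ((V j).addCaret j) (comb d (n + N + 1)) h) ∈ K := by
  have hd := C.two_le
  have hUc := hU.trans (numLeaves_comb hd n).symm
  suffices H : ∀ j ≤ (n + N) * (d - 1), ∃ V : DaryTree d, U.Le V ∧
      V.numLeaves = (n + N) * (d - 1) + 1 ∧
      ∃ h, ((C.frac U (comb d n) hUc)⁻¹ *
        C.frac (V.addCaret j) (comb d (n + N + 1)) h) ∈ K by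
    have : Nonempty (DaryTree d) := ⟨U⟩
    choose! V hV using H
    exact ⟨V, hV⟩
  intro j hj
  have hlen : ∀ V : DaryTree d, V.numLeaves = (n + N) * (d - 1) + 1 →
      (V.addCaret j).numLeaves = (comb d (n + N + 1)).numLeaves := fun V hV => by
    rw [numLeaves_addCaret_eq hd hV hj, numLeaves_comb hd]
  rcases hj.eq_or_lt with rfl | hj'
  · -- Carets at the last leaf do not change the class, so no compensation is needed.
    have h1 := numLeaves_addLastCarets hd hU N
    refine ⟨U.addLastCarets n N, .addLastCarets _ _ _, h1, hlen _ h1, ?_⟩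
    rw [C.frac_addCaret_comb_last (by rw [h1, numLeaves_comb hd]),
      C.frac_addLastCarets_comb hUc, inv_mul_cancel]
    exact K.one_mem
  · -- The `r`-th leaf of `U` must exist and not be the last one, while `j` can be larger.
    obtain ⟨r, hr, hrel⟩ : ∃ r < n * (d - 1), C.gen r ^ N * C.gen j ∈ K := by
      by_cases hjn : j < n * (d - 1)
      · exact ⟨j, hjn, by rw [← pow_succ]; exact hN _⟩
      · obtain ⟨m, rfl⟩ := Nat.exists_eq_add_of_le hn
        have e1 : (N + 2 + m) * (d - 1) = (N + 1) * (d - 1) + (d - 1) + m * (d - 1) := by ring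
        have e2 : (N + 2 + m + N) * (d - 1) = (N + 2 + m) * (d - 1) + N * (d - 1) := by ring
        have e3 : (N + 1) * (d - 1) = N * (d - 1) + (d - 1) := by ring
        obtain ⟨r, hr⟩ := Nat.exists_eq_add_of_le
          (show (N + 1) * (d - 1) ≤ j by omega)
        refine ⟨r, by omega, ?_⟩
        have h1 := C.gen_mul_gen_zero_pow (j := r) (by omega) (N + 1)
        rw [add_comm r, ← hr] at h1
        have h2 : C.gen r ^ N * C.gen j = (C.gen r ^ (N + 1)) *
            ((C.gen r)⁻¹ * (C.gen 0 ^ (N + 1))⁻¹ * C.gen r) * C.gen 0 ^ (N + 1) := by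
          rw [mul_assoc, mul_assoc _ (C.gen r), h1, pow_succ]
          group
        rw [h2]
        refine K.mul_mem (K.mul_mem (hN _) ?_) (hN _)
        have := Subgroup.Normal.conj_mem ‹K.Normal› _ (K.inv_mem (hN (C.gen 0))) (C.gen r)⁻¹
        simpa using this
    have h1 := numLeaves_addCarets hd hU hr.le N
    refine ⟨U.addCarets r N, .addCarets _ _ _, h1, hlen _ h1, ?_⟩
    rw [C.frac_addCaret_comb hj' (by rw [h1, numLeaves_comb hd]),
      C.frac_addCarets_comb hr hUc, mul_assoc, inv_mul_cancel_left]
    exact hrel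

/-- For a diverse cloning system, an element with finitely many conjugates under the
Higman--Thompson group lies in the Higman--Thompson group. -/
theorem mem_F_of_finite_conj (hC : C.Diverse) {x : C.Thompson}
    (hx : {y : C.Thompson | ∃ f ∈ C.F, y = f⁻¹ * x * f}.Finite) : x ∈ C.F := by
  have hd := C.two_le
  obtain ⟨n₀, hn₀⟩ := hC
  obtain ⟨K, hK, hKfin, hcomm⟩ := C.F.exists_normal_finiteIndex_commute x hx
  obtain ⟨N, hN⟩ := Nat.exists_eq_succ_of_ne_zero hKfin.index_ne_zero
  obtain ⟨a, rfl⟩ : ∃ a, C.cls a = x := Quot.exists_rep x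
  -- Expand the given triple until its right tree has many carets.
  obtain ⟨U, haU, hcU⟩ := exists_le_le a.U (comb d (N + 2 + n₀))
  obtain ⟨n, hU⟩ := exists_numLeaves_eq hd U
  have hn : N + 2 + n₀ ≤ n := by
    have := hcU.numLeaves_le hd
    rw [numLeaves_comb hd, hU] at this
    exact Nat.le_of_mul_le_mul_right (by omega) (show 0 < d - 1 by omega)
  obtain ⟨V, hV⟩ := exists_trees_mod K hU (N := N)
    (fun f => by have := K.pow_index_mem f; rwa [hN] at this) (by omega)
  set p := (n + N) * (d - 1) + 1 with hp
  have hpn : n₀ ≤ p := by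
    have : n * 1 ≤ (n + N) * (d - 1) := Nat.mul_le_mul (by omega) (by omega)
    omega
  have key : ∀ j : Fin p, ∃ (A : DaryTree d) (g : G p) (hA : A.numLeaves = p + (d - 1))
      (hW : ((V j).addCaret j).numLeaves = p + (d - 1)),
      C.cls ⟨p + (d - 1), A, C.κ p j g, (V j).addCaret j, hA, hW⟩ = C.cls a := by
    intro j
    obtain ⟨h1, h2, -⟩ := hV j (by omega)
    obtain ⟨⟨m, T, g, W, hT, hW⟩, hb, rfl⟩ := exists_expands (C := C) a (V j) (haU.trans h1)
    obtain rfl : m = p := hW.symm.trans h2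
    exact ⟨_, g, _, _, (cls_expand C ⟨p, T, g, V j, hT, hW⟩ j).trans hb.cls_eq.symm⟩
  choose A g hA hW hcls using key
  have heq : ∀ i j : Fin p, C.κ p i (g i) = C.κ p j (g j) := by
    intro i j
    refine eq_of_commute_frac (hA i) (hW i) (hA j) (hW j) (hcls i) (hcls j) (hcomm _ ?_)
    obtain ⟨-, -, h1, h2⟩ := hV i (by omega)
    obtain ⟨-, -, h3, h4⟩ := hV j (by omega)
    have h5 := K.mul_mem h2 (K.inv_mem h4)
    rw [mul_inv_rev, inv_inv, mul_assoc, ← mul_assoc (C.frac _ _ h1), frac_inv C _ _ h3,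
      frac_mul, ← mul_assoc] at h5
    have := hK.conj_mem _ h5 (C.frac U (comb d n) (hU.trans (numLeaves_comb hd n).symm))
    simpa [mul_assoc] using this
  have h0 : 0 < p := by omega
  have hmem : C.κ p ⟨0, h0⟩ (g ⟨0, h0⟩) ∈ ⋂ k : Fin p, Set.range (C.κ p k) :=
    Set.mem_iInter.2 fun k => ⟨g k, heq _ _⟩
  rw [hn₀ p hpn, Set.mem_singleton_iff] at hmem
  have := hcls ⟨0, h0⟩
  rw [hmem] at this
  exact ⟨_, _, _, hA _, hW _, this.symm⟩

theorem infinite_conj (hC : C.Diverse) {x : C.Thompson} (hx : x ≠ 1) :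
    {y : C.Thompson | ∃ f ∈ C.F, y = f⁻¹ * x * f}.Infinite := by
  by_contra h
  rw [Set.not_infinite] at h
  exact infinite_conj_of_mem_F (mem_F_of_finite_conj hC h) hx h

end CloningSystem

/-! ### Group von Neumann algebras and their relative commutants -/

section GroupVonNeumann

variable {Γ : Type*} [Group Γ]

theorem leftRegular_apply (g : Γ) (ψ : EllTwo Γ) (h : Γ) : leftRegular g ψ h = ψ (g⁻¹ * h) := rfl

/-- Right translation `(ρ_g ψ)(h) = ψ(h g)` as a linear isometry of `ℓ²(Γ)`. -/
noncomputable def rightRegularIsometry (g : Γ) : EllTwo Γ →ₗᵢ[ℂ] EllTwo Γ where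
  toFun ψ := ⟨fun h => ψ (h * g), by
    have h := lp.memℓp ψ
    change Memℓp (fun h => ψ (h * g)) 2
    rw [memℓp_gen_iff (by simp)] at h ⊢
    exact (Equiv.mulRight g).summable_iff.2 h⟩
  map_add' _ _ := rfl
  map_smul' _ _ := rfl
  norm_map' ψ := by
    rw [lp.norm_eq_tsum_rpow (by simp), lp.norm_eq_tsum_rpow (by simp)]
    congr 1
    exact (Equiv.mulRight g).tsum_eq fun h => ‖ψ h‖ ^ (2 : ℝ≥0∞).toReal

/-- The right regular representation `ρ : Γ → B(ℓ²(Γ))`. -/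
noncomputable def rightRegular (g : Γ) : EllTwo Γ →L[ℂ] EllTwo Γ :=
  (rightRegularIsometry g).toContinuousLinearMap

theorem rightRegular_apply (g : Γ) (ψ : EllTwo Γ) (h : Γ) : rightRegular g ψ h = ψ (h * g) := rfl

theorem leftRegular_mul_rightRegular (g h : Γ) :
    leftRegular g * rightRegular h = rightRegular h * leftRegular g := by
  ext ψ k
  simp only [mul_apply_eq_comp, leftRegular_apply, rightRegular_apply, mul_assoc]

open scoped Classical in
theorem leftRegular_single (g h : Γ) (c : ℂ) :
    leftRegular g (lp.single 2 h c : EllTwo Γ) = lp.single 2 (g * h) c := by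
  ext k
  simp only [leftRegular_apply, lp.coeFn_single, Pi.single_apply, inv_mul_eq_iff_eq_mul]

open scoped Classical in
theorem rightRegular_single (g h : Γ) (c : ℂ) :
    rightRegular g (lp.single 2 h c : EllTwo Γ) = lp.single 2 (h * g⁻¹) c := by
  ext k
  simp only [rightRegular_apply, lp.coeFn_single, Pi.single_apply, eq_mul_inv_iff_mul_eq]

theorem star_leftRegular (g : Γ) : star (leftRegular g) = leftRegular g⁻¹ := by
  have h : leftRegular g * leftRegular g⁻¹ = (1 : EllTwo Γ →L[ℂ] EllTwo Γ) := by
    ext ψ k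
    simp [mul_apply_eq_comp, leftRegular_apply]
  have h' : star (leftRegular g) * leftRegular g = (1 : EllTwo Γ →L[ℂ] EllTwo Γ) := by
    rw [ContinuousLinearMap.star_eq_adjoint]
    exact ContinuousLinearMap.norm_map_iff_adjoint_comp_self _ |>.1
      (leftRegularIsometry g).norm_map
  exact left_inv_eq_right_inv h' h

end GroupVonNeumann

section VonNeumann

variable {H : Type*} [NormedAddCommGroup H] [InnerProductSpace ℂ H] [CompleteSpace H]

theorem mem_vonNeumannGenerated_iff {S : Set (H →L[ℂ] H)} {x : H →L[ℂ] H} :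
    x ∈ vonNeumannGenerated S ↔ ∀ y : H →L[ℂ] H,
      (∀ s ∈ S, s * y = y * s ∧ star s * y = y * star s) → y * x = x * y := by
  have h : x ∈ vonNeumannGenerated S ↔ x ∈ StarSubalgebra.centralizer ℂ
      (StarSubalgebra.centralizer ℂ S : Set (H →L[ℂ] H)) := Iff.rfl
  simp only [h, StarSubalgebra.mem_centralizer_iff, SetLike.mem_coe]
  refine ⟨fun h y hy => (h y hy).1, fun h y hy => ⟨h y hy, h (star y) ?_⟩⟩
  have := star_mem (StarSubalgebra.mem_centralizer_iff ℂ |>.2 hy)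
  exact StarSubalgebra.mem_centralizer_iff ℂ |>.1 this

theorem subset_vonNeumannGenerated (S : Set (H →L[ℂ] H)) {s : H →L[ℂ] H} (hs : s ∈ S) :
    s ∈ vonNeumannGenerated S :=
  mem_vonNeumannGenerated_iff.2 fun _ hy => (hy s hs).1.symm

theorem vonNeumannGenerated_mono {S S' : Set (H →L[ℂ] H)} (h : S ⊆ S') :
    vonNeumannGenerated S ≤ vonNeumannGenerated S' := fun _ hx =>
  mem_vonNeumannGenerated_iff.2 fun y hy => mem_vonNeumannGenerated_iff.1 hx y fun s hs =>
    hy s (h hs)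

theorem smul_one_mem_relativeCommutant (N M : VonNeumannAlgebra H) (c : ℂ) :
    c • (1 : H →L[ℂ] H) ∈ relativeCommutant N M :=
  ⟨M.toStarSubalgebra.smul_mem (one_mem M) c, fun y _ => by simp⟩

theorem relativeCommutant_mono_right (N : VonNeumannAlgebra H) {M M' : VonNeumannAlgebra H}
    (h : M ≤ M') : relativeCommutant N M ⊆ relativeCommutant N M' :=
  fun _ hx => ⟨h hx.1, hx.2⟩

end VonNeumann

section GroupVonNeumann

variable {Γ : Type*} [Group Γ]

theorem subgroupVonNeumann_le (K : Subgroup Γ) : subgroupVonNeumann K ≤ groupVonNeumann Γ :=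
  vonNeumannGenerated_mono (Set.image_subset_range _ _)

theorem rightRegular_mul_comm {X : EllTwo Γ →L[ℂ] EllTwo Γ} (hX : X ∈ groupVonNeumann Γ) (g : Γ) :
    rightRegular g * X = X * rightRegular g := by
  refine mem_vonNeumannGenerated_iff.1 hX _ ?_
  rintro _ ⟨h, rfl⟩
  rw [star_leftRegular]
  exact ⟨leftRegular_mul_rightRegular h g, leftRegular_mul_rightRegular h⁻¹ g⟩

/-- A square-summable function vanishes wherever it takes the same value infinitely often. -/
theorem EllTwo.eq_zero_of_infinite {ι : Type*} (ξ : EllTwo ι) (x : ι) (s : Set ι) (hs : s.Infinite)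
    (h : ∀ y ∈ s, ξ y = ξ x) : ξ x = 0 := by
  by_contra hne
  have hsum : Summable fun y => ‖ξ y‖ ^ (2 : ℝ≥0∞).toReal :=
    (memℓp_gen_iff (by simp)).1 (lp.memℓp ξ)
  have hpos : 0 < ‖ξ x‖ ^ (2 : ℝ≥0∞).toReal := by positivity
  refine hs ((hsum.tendsto_cofinite_zero.eventually_lt_const hpos).subset ?_)
  intro y hy
  simp [h y hy]

/-- If every non-trivial element of `Γ` has infinitely many conjugates under the subgroup `K`, the
relative commutant of `L(K)` in `L(Γ)` consists of the scalars. -/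
theorem relativeCommutant_eq_scalars (K : Subgroup Γ)
    (hK : ∀ x : Γ, x ≠ 1 → {y : Γ | ∃ f ∈ K, y = f⁻¹ * x * f}.Infinite) :
    relativeCommutant (subgroupVonNeumann K) (groupVonNeumann Γ) = {x | ∃ c : ℂ, x = c • 1} := by
  classical
  ext X
  constructor
  · rintro ⟨hX, hcomm⟩
    -- `X` is determined by `ξ = X δ₁`, which is constant on `K`-conjugacy classes.
    set ξ : EllTwo Γ := X (lp.single 2 1 1) with hξ
    have hconj : ∀ f ∈ K, ∀ y, ξ (f⁻¹ * y * f) = ξ y := by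
      intro f hf y
      have h1 := hcomm (leftRegular f) (subset_vonNeumannGenerated _ ⟨f, hf, rfl⟩)
      have h2 := rightRegular_mul_comm hX f
      have h3 : rightRegular f (leftRegular f ξ) = ξ := by
        rw [hξ, ← mul_apply_eq_comp (leftRegular f), h1,
          mul_apply_eq_comp, leftRegular_single,
          ← mul_apply_eq_comp (rightRegular f), h2,
          mul_apply_eq_comp, rightRegular_single]
        simp
      have h4 := congrArg (fun ψ : EllTwo Γ => ψ y) h3
      simpa [rightRegular_apply, leftRegular_apply, mul_assoc] using h4
    have hzero : ∀ y, y ≠ 1 → ξ y = 0 := fun y hy => by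
      refine EllTwo.eq_zero_of_infinite ξ y _ (hK y hy) ?_
      rintro _ ⟨f, hf, rfl⟩
      exact hconj f hf y
    have hξ1 : ξ = lp.single 2 1 (ξ 1) := by
      ext y
      by_cases hy : y = 1
      · subst hy; simp
      · simp [hzero y hy, hy]
    refine ⟨ξ 1, ?_⟩
    have hsingle : ∀ g (a : ℂ), X (lp.single 2 g a) = ξ 1 • (lp.single 2 g a : EllTwo Γ) := by
      intro g a
      have h2 := rightRegular_mul_comm hX g⁻¹
      have e : (lp.single 2 g a : EllTwo Γ) = a • rightRegular g⁻¹ (lp.single 2 1 1) := by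
        rw [rightRegular_single, ← lp.single_smul]
        simp
      rw [e, map_smul, ← mul_apply_eq_comp X, ← h2, mul_apply_eq_comp, ← hξ,
        hξ1, rightRegular_single, rightRegular_single, smul_comm]
      congr 1
      rw [← lp.single_smul]
      simp
    ext1 ψ
    have hψ := lp.hasSum_single (p := 2) (by simp) ψ
    have h1 := X.hasSum hψ
    have h2 := hψ.const_smul (ξ 1)
    simp only [hsingle] at h1
    exact h1.unique h2
  · rintro ⟨c, rfl⟩
    exact smul_one_mem_relativeCommutant _ _ c

end GroupVonNeumann

theorem mainTheorem1 {d : ℕ} {G : ℕ → Type*} [∀ n, Group (G n)] (C : CloningSystem d G)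
    (hC : C.Diverse) :
    (∀ x : C.Thompson, x ≠ 1 → {y : C.Thompson | ∃ f ∈ C.F, y = f⁻¹ * x * f}.Infinite) ∧
    IsICC C.Thompson ∧
    IsIrreducibleInclusion (subgroupVonNeumann C.F) (groupVonNeumann C.Thompson) ∧
    relativeCommutant (subgroupVonNeumann C.F) (groupVonNeumann C.Thompson) =
      {x | ∃ c : ℂ, x = c • 1} := by
  have ha : ∀ x : C.Thompson, x ≠ 1 →
      {y : C.Thompson | ∃ f ∈ C.F, y = f⁻¹ * x * f}.Infinite :=
    fun x hx => CloningSystem.infinite_conj hC hx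
  have hcomm := relativeCommutant_eq_scalars C.F ha
  have hle := subgroupVonNeumann_le C.F
  refine ⟨ha, fun x hx => (ha x hx).mono ?_, ⟨hle, ?_⟩, hcomm⟩
  · rintro _ ⟨f, -, rfl⟩
    exact isConj_iff.2 ⟨f⁻¹, by simp⟩
  · refine subset_antisymm ?_ (relativeCommutant_mono_right _ hle)
    rw [hcomm]
    rintro _ ⟨c, rfl⟩
    exact smul_one_mem_relativeCommutant _ _ c
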